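/- Theorem (Alon & Vũ). For $n\ge 1$ let $\chi(n)$ be the maximal absolute value of an entry of $A^{-1}$, taken over all invertible $n\times n$ matrices $A$ with entries in $\{0,1\}$, and for $n\ge 0$ let $\rho_n$ be the maximal determinant of an $n\times n$ matrix with entries in $\{0,1\}$ (so $\rho_0=1$, the empty determinant). There is a function $f:\mathbb N\to\mathbb R$ with $f(n)=o(n)$ as $n\to\infty$ such that the following hold. (1) For every $n\ge 1$, $$\frac{n^{n/2}}{2^{2n+f(n)}}\ \le\ \chi(n)\ \le\ \rho_{n-1}\ \le\ \frac{n^{n/2}}{2^{n-1}}.$$ (2) If $n$ is a power of $2$, then the better lower bound $\dfrac{n^{n/2}}{2^{n+f(n)}}\le\chi(n)$ holds. (3) Matrices that realize these lower bounds can be effectively constructed: there is a computable function that maps $(n,i,j)$ to the $(i,j)$ entry of an invertible $n\times n$ matrix $A_n$ with entries in $\{0,1\}$, for all $n\ge1$ and all positions $(i,j)$, such that the maximal absolute value of an entry of $A_n^{-1}$ is at least $n^{n/2}/2^{2n+f(n)}$ for every $n\ge1$, and at least $n^{n/2}/2^{n+f(n)}$ whenever $n$ is a power of $2$. -/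

import Mathlib

open Filter Asymptotics

noncomputable section

/-- All entries of the square matrix `A` are `0` or `1`. -/
def IsZeroOne {n : ℕ} (A : Matrix (Fin n) (Fin n) ℝ) : Prop :=
  ∀ i j, A i j = 0 ∨ A i j = 1

/-- The largest absolute value of an entry of the inverse of `A`
(meaningful for an invertible matrix of size at least one). -/
def maxInvEntry {n : ℕ} (A : Matrix (Fin n) (Fin n) ℝ) : ℝ :=
  ⨆ p : Fin n × Fin n, |A⁻¹ p.1 p.2|

/-- The values `maxInvEntry A`, for `A` an invertible `0/1`-matrix of size `n`. -/
def invEntryValues (n : ℕ) : Set ℝ :=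
  {x | ∃ A : Matrix (Fin n) (Fin n) ℝ, IsZeroOne A ∧ IsUnit A ∧ maxInvEntry A = x}

/-- The maximal absolute value of an entry in the inverse of an invertible
`0/1`-matrix of size `n`. -/
def chi (n : ℕ) : ℝ := sSup (invEntryValues n)

/-- The determinants of `0/1`-matrices of size `n`. -/
def detValues (n : ℕ) : Set ℝ :=
  {x | ∃ A : Matrix (Fin n) (Fin n) ℝ, IsZeroOne A ∧ A.det = x}

/-- The maximal determinant of a `0/1`-matrix of size `n`
(for `n = 0` this is the empty determinant `1`). -/
def rho (n : ℕ) : ℝ := sSup (detValues n)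

/-- The `n × n` matrix whose entry in row `i`, column `j` (counted from `0`) is `1` if
`a (n, i, j)` is true and `0` otherwise. -/
def zeroOneMatrix (a : ℕ × ℕ × ℕ → Bool) (n : ℕ) : Matrix (Fin n) (Fin n) ℝ :=
  Matrix.of fun i j => if a (n, (i : ℕ), (j : ℕ)) = true then 1 else 0

theorem isZeroOne_zeroOneMatrix (a : ℕ × ℕ × ℕ → Bool) (n : ℕ) :
    IsZeroOne (zeroOneMatrix a n) := by
  intro i j
  simp only [zeroOneMatrix, Matrix.of_apply]
  split_ifs <;> simp

theorem finite_isZeroOne (n : ℕ) : {A : Matrix (Fin n) (Fin n) ℝ | IsZeroOne A}.Finite := by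
  refine (Set.Finite.pi' fun _ : Fin n => Set.Finite.pi' fun _ : Fin n =>
    Set.toFinite ({0, 1} : Set ℝ)).subset ?_
  intro A hA i j
  simpa using hA i j

theorem isZeroOne_one (n : ℕ) : IsZeroOne (1 : Matrix (Fin n) (Fin n) ℝ) := by
  intro i j
  rw [Matrix.one_apply]
  split_ifs <;> simp

/-- The supremum in the definition of `chi` is a maximum. -/
theorem isGreatest_chi (n : ℕ) : IsGreatest (invEntryValues n) (chi n) := by
  have hf : (invEntryValues n).Finite := by
    refine ((finite_isZeroOne n).image maxInvEntry).subset ?_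
    rintro x ⟨A, hA, -, rfl⟩
    exact ⟨A, hA, rfl⟩
  have hne : (invEntryValues n).Nonempty := ⟨_, 1, isZeroOne_one n, isUnit_one, rfl⟩
  exact ⟨hne.csSup_mem hf, fun x hx => le_csSup hf.bddAbove hx⟩

/-- The supremum in the definition of `rho` is a maximum. -/
theorem isGreatest_rho (n : ℕ) : IsGreatest (detValues n) (rho n) := by
  have hf : (detValues n).Finite := by
    refine ((finite_isZeroOne n).image Matrix.det).subset ?_
    rintro x ⟨A, hA, rfl⟩
    exact ⟨A, hA, rfl⟩
  have hne : (detValues n).Nonempty := ⟨_, 1, isZeroOne_one n, rfl⟩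
  exact ⟨hne.csSup_mem hf, fun x hx => le_csSup hf.bddAbove hx⟩

end

/-! For the lower bound at `n = 2 ^ m`, index rows and columns by subsets of an `m`-element set and
let `χ_s(t) = (-1)^|s ∩ t|`, the rows of a Hadamard matrix. List the subsets by increasing size so
that each has exactly one element outside its predecessor (`exists_enum_subsets`). For consecutive
sets `p`, `q` with `|q| = k`, `rowSign` is a `±1` row, and `2^(k-1)` times it equals `χ_q - (2^(k-1)
- 1) χ_p` plus characters of sets listed before `p` (`two_pow_mul_rowSign`). So the system with
these rows is triangular in the character sums `X_i`, and forward substitution from a unit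
right-hand side gives `X_{i+1} ≈ (2^(k-1) - 1) X_i`. Multiplying over all subsets yields `2^(m 2^m /
2 - 2^m) = n^(n/2) / 2^n`. The corrections cost `∑ O(2^(-|s|)) = O((3/2)^m) = o(n)` in the exponent
(`rpow_le_of_recurrence`). As the last `X_i` is a signed sum of the solution, the inverse has a
large entry (`rpow_le_maxInvEntry_enumMatrix`).

Other sizes follow from `chi s * chi t ≤ chi (s + t)`, splitting off the largest power of two each
time; the entropy of the split costs the second factor `2^n` (`rpow_le_chi`).

For the upper bounds, an inverse entry is a minor divided by a nonzero integer determinant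
(`chi_succ_le_rho`), and bordering a `0/1`-matrix turns it into a sign matrix, to which Hadamard's
inequality applies (`IsZeroOne.det_le`).

Effectiveness comes from search: an integer certificate (a matrix, a scaled inverse and a large
entry) can be checked by primitive recursion, and the lower bound on `chi` guarantees that one
exists (`exists_isCertificate`, `exists_computable_selector`). -/

/-! ### Gray-code enumeration of subsets by size -/

/-- Two finite sets that differ by exchanging one element. -/
def SwapAdj (p q : Finset ℕ) : Prop := (q \ p).card = 1 ∧ (p \ q).card = 1

theorem SwapAdj.symm {p q : Finset ℕ} (h : SwapAdj p q) : SwapAdj q p := ⟨h.2, h.1⟩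

theorem SwapAdj.insert {p q : Finset ℕ} {a : ℕ} (hp : a ∉ p) (hq : a ∉ q) (h : SwapAdj p q) :
    SwapAdj (insert a p) (insert a q) := by
  have key : ∀ s t : Finset ℕ, a ∉ s → Insert.insert a s \ Insert.insert a t = s \ t := by
    intro s t hs
    ext x
    simp only [Finset.mem_sdiff, Finset.mem_insert]
    grind
  exact ⟨by rw [key _ _ hq]; exact h.1, by rw [key _ _ hp]; exact h.2⟩

/-- The revolving door list of the `k`-element subsets of `{0, …, m - 1}`. -/
def revolvingDoor : ℕ → ℕ → List (Finset ℕ)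
  | _, 0 => [∅]
  | 0, _ + 1 => []
  | m + 1, k + 1 =>
    revolvingDoor m (k + 1) ++ (revolvingDoor m k).reverse.map (insert m)

theorem mem_revolvingDoor (m k : ℕ) (s : Finset ℕ) :
    s ∈ revolvingDoor m k ↔ s ∈ Finset.powersetCard k (Finset.range m) := by
  induction m generalizing k s with
  | zero =>
    cases k with
    | zero => simp [revolvingDoor]
    | succ k =>
      simp only [revolvingDoor, List.not_mem_nil, Finset.range_zero, Finset.mem_powersetCard,
        Finset.subset_empty, false_iff, not_and]
      rintro rfl
      simp
  | succ m ih =>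
    cases k with
    | zero => simp [revolvingDoor]
    | succ k =>
      rw [Finset.range_add_one, Finset.powersetCard_succ_insert (by simp)]
      simp only [revolvingDoor, List.mem_append, List.mem_map, List.mem_reverse, ih,
        Finset.mem_union, Finset.mem_image]

theorem revolvingDoor_notMem {m k : ℕ} {s : Finset ℕ} (h : s ∈ revolvingDoor m k) : m ∉ s := by
  rw [mem_revolvingDoor, Finset.mem_powersetCard] at h
  intro hm
  simpa using h.1 hm

theorem nodup_revolvingDoor (m k : ℕ) : (revolvingDoor m k).Nodup := by
  induction m generalizing k with
  | zero => cases k <;> simp [revolvingDoor]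
  | succ m ih =>
    cases k with
    | zero => simp [revolvingDoor]
    | succ k =>
      rw [revolvingDoor, List.nodup_append]
      refine ⟨ih _, ?_, ?_⟩
      · refine List.Nodup.map_on ?_ (List.nodup_reverse.2 (ih k))
        intro s hs t ht hst
        have hs := revolvingDoor_notMem (List.mem_reverse.1 hs)
        have ht := revolvingDoor_notMem (List.mem_reverse.1 ht)
        rw [← Finset.erase_insert hs, hst, Finset.erase_insert ht]
      · rintro s hs t ht rfl
        obtain ⟨u, -, rfl⟩ := List.mem_map.1 ht
        exact revolvingDoor_notMem hs (Finset.mem_insert_self _ _)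

theorem revolvingDoor_eq_nil {m k : ℕ} (h : m < k) : revolvingDoor m k = [] := by
  rw [List.eq_nil_iff_forall_not_mem]
  intro s hs
  rw [mem_revolvingDoor, Finset.powersetCard_eq_empty.2 (by simpa using h)] at hs
  simp at hs

theorem revolvingDoor_self (m : ℕ) : revolvingDoor m m = [Finset.range m] := by
  induction m with
  | zero => simp [revolvingDoor]
  | succ m ih =>
    rw [revolvingDoor, revolvingDoor_eq_nil (Nat.lt_succ_self m), ih]
    simp [Finset.range_add_one]

theorem head?_revolvingDoor {m k : ℕ} (h : k ≤ m) :
    (revolvingDoor m k).head? = some (Finset.range k) := by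
  induction m generalizing k with
  | zero => obtain rfl : k = 0 := by omega
            simp [revolvingDoor]
  | succ m ih =>
    rcases h.eq_or_lt with rfl | h
    · simp [revolvingDoor_self]
    · cases k with
      | zero => simp [revolvingDoor]
      | succ k =>
        rw [revolvingDoor, List.head?_append, ih (by omega)]
        rfl

theorem getLast?_revolvingDoor {m k : ℕ} (h : k ≤ m) :
    (revolvingDoor (m + 1) (k + 1)).getLast? = some (insert m (Finset.range k)) := by
  rw [revolvingDoor, List.getLast?_append, List.getLast?_map, List.getLast?_reverse,
    head?_revolvingDoor h]
  rfl

/-- Reversing the second half makes the halves fit: in general the first ends in `{m - 1} ∪ {0, …, k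
- 1}` and the second begins with `{m, m - 1} ∪ {0, …, k - 2}`, so `k - 1` is exchanged for `m`. -/
theorem isChain_revolvingDoor (m k : ℕ) : (revolvingDoor m k).IsChain SwapAdj := by
  induction m generalizing k with
  | zero => cases k <;> simp [revolvingDoor]
  | succ m ih =>
    cases k with
    | zero => simp [revolvingDoor]
    | succ k =>
      rw [revolvingDoor, List.isChain_append]
      refine ⟨ih _, ?_, ?_⟩
      · rw [List.isChain_map, List.isChain_reverse]
        refine (List.isChain_iff_getElem.2 ?_)
        intro i hi
        exact ((List.isChain_iff_getElem.1 (ih k) i hi).insert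
          (revolvingDoor_notMem (List.getElem_mem _))
          (revolvingDoor_notMem (List.getElem_mem _))).symm
      · intro p hp q hq
        rcases Nat.lt_or_ge m (k + 1) with hmk | hmk
        · simp [revolvingDoor_eq_nil hmk] at hp
        obtain ⟨m, rfl⟩ : ∃ m', m = m' + 1 := ⟨m - 1, by omega⟩
        rw [getLast?_revolvingDoor (by omega)] at hp
        simp only [List.head?_map, List.head?_reverse] at hq
        obtain rfl : insert m (Finset.range k) = p := by simpa using hp
        cases k with
        | zero =>
          obtain rfl : {m + 1} = q := by simpa [revolvingDoor] using hq
          constructor <;> rw [Finset.card_eq_one]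
          · exact ⟨m + 1, by ext x; simp; omega⟩
          · exact ⟨m, by ext x; simp; omega⟩
        | succ k =>
          rw [getLast?_revolvingDoor (by omega)] at hq
          obtain rfl : insert (m + 1) (insert m (Finset.range k)) = q := by simpa using hq
          constructor <;> rw [Finset.card_eq_one]
          · exact ⟨m + 1, by ext x; simp; omega⟩
          · exact ⟨k, by ext x; simp; omega⟩

/-- The subsets of `{0, …, m - 1}` with at most `k` elements, listed by increasing cardinality,
each level traversed in revolving door order or its reverse. -/
def levelList (m : ℕ) : ℕ → List (Finset ℕ)
  | 0 => [∅]
  | k + 1 => levelList m k ++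
      if Even k then (revolvingDoor m (k + 1)).reverse else revolvingDoor m (k + 1)

theorem mem_levelList (m k : ℕ) (s : Finset ℕ) :
    s ∈ levelList m k ↔ s ⊆ Finset.range m ∧ s.card ≤ k := by
  induction k with
  | zero => simp +contextual [levelList]
  | succ k ih =>
    have : s ∈ (if Even k then (revolvingDoor m (k + 1)).reverse else revolvingDoor m (k + 1)) ↔
        s ∈ revolvingDoor m (k + 1) := by split_ifs <;> simp
    rw [levelList, List.mem_append, ih, this, mem_revolvingDoor, Finset.mem_powersetCard,
      ← and_or_left]
    refine and_congr_right fun _ => by omega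

theorem pairwise_levelList (m k : ℕ) :
    (levelList m k).Pairwise fun s t => s.card ≤ t.card ∧ s ≠ t := by
  induction k with
  | zero => simp [levelList]
  | succ k ih =>
    rw [levelList, List.pairwise_append]
    refine ⟨ih, ?_, ?_⟩
    · have hn : (if Even k then (revolvingDoor m (k + 1)).reverse
          else revolvingDoor m (k + 1)).Nodup := by
        split_ifs <;> simp [nodup_revolvingDoor]
      refine hn.imp_of_mem ?_
      intro s t hs ht hst
      have key : ∀ u, u ∈ (if Even k then (revolvingDoor m (k + 1)).reverse
          else revolvingDoor m (k + 1)) → u.card = k + 1 := by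
        intro u hu
        have : u ∈ revolvingDoor m (k + 1) := by split_ifs at hu <;> simpa using hu
        rw [mem_revolvingDoor, Finset.mem_powersetCard] at this
        exact this.2
      exact ⟨(key s hs).trans (key t ht).symm |>.le, hst⟩
    · intro s hs t ht
      have ht : t ∈ revolvingDoor m (k + 1) := by split_ifs at ht <;> simpa using ht
      rw [mem_revolvingDoor, Finset.mem_powersetCard] at ht
      have hs := ((mem_levelList m k s).1 hs).2
      refine ⟨by omega, ?_⟩
      rintro rfl
      omega

theorem getLast?_levelList_succ {m k : ℕ} (h : k ≤ m) :
    (levelList (m + 1) (k + 1)).getLast? =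
      some (if Even k then Finset.range (k + 1) else insert m (Finset.range k)) := by
  rw [levelList, List.getLast?_append]
  split_ifs
  · rw [List.getLast?_reverse, head?_revolvingDoor (by omega)]
    rfl
  · rw [getLast?_revolvingDoor h]
    rfl

/-- Alternating the direction of the levels makes the last set of a level a subset of the first set
of the next. Only the one-sided condition survives there, since the size jumps. -/
theorem isChain_levelList {m k : ℕ} (h : k ≤ m) :
    (levelList m k).IsChain fun p q => (q \ p).card = 1 := by
  induction k with
  | zero => simp [levelList]
  | succ k ih =>
    rw [levelList, List.isChain_append]
    refine ⟨ih (by omega), ?_, ?_⟩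
    · split_ifs
      · rw [List.isChain_reverse]
        exact (isChain_revolvingDoor m (k + 1)).imp fun _ _ h => h.2
      · exact (isChain_revolvingDoor m (k + 1)).imp fun _ _ h => h.1
    · intro p hp q hq
      obtain ⟨m, rfl⟩ : ∃ m', m = m' + 1 := ⟨m - 1, by omega⟩
      have hq : (if Even k then insert m (Finset.range k) else Finset.range (k + 1)) = q := by
        split_ifs at hq ⊢
        · rw [List.head?_reverse, getLast?_revolvingDoor (by omega)] at hq
          simpa using hq
        · rw [head?_revolvingDoor h] at hq
          simpa using hq
      cases k with
      | zero =>
        obtain rfl : ∅ = p := by simpa [levelList] using hp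
        simp [← hq]
      | succ k =>
        rw [getLast?_levelList_succ (by omega)] at hp
        obtain rfl : (if Even k then Finset.range (k + 1) else insert m (Finset.range k)) = p := by
          simpa using hp
        rw [Finset.card_eq_one]
        by_cases hk : Even k
        · have hk' : ¬ Even (k + 1) := by simpa [Nat.even_add_one] using hk
          rw [if_neg hk'] at hq
          exact ⟨k + 1, by subst hq; ext x; simp [hk]; omega⟩
        · have hk' : Even (k + 1) := by simpa [Nat.even_add_one] using hk
          rw [if_pos hk'] at hq
          exact ⟨k, by subst hq; ext x; simp [hk]; omega⟩

/-- The subsets of `{0, …, m - 1}` can be enumerated by increasing cardinality such that each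
one has exactly one element outside its predecessor. -/
theorem exists_enum_subsets (m : ℕ) : ∃ α : ℕ → Finset ℕ,
    (∀ i < 2 ^ m, α i ⊆ Finset.range m) ∧
    (∀ i < 2 ^ m, ∀ j < 2 ^ m, α i = α j → i = j) ∧
    (∀ s ⊆ Finset.range m, ∃ i < 2 ^ m, α i = s) ∧
    (∀ i j, i ≤ j → j < 2 ^ m → (α i).card ≤ (α j).card) ∧
    (∀ i, i + 1 < 2 ^ m → (α (i + 1) \ α i).card = 1) := by
  have hmem : ∀ s, s ∈ levelList m m ↔ s ∈ (Finset.range m).powerset := by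
    intro s
    rw [mem_levelList, Finset.mem_powerset, and_iff_left_iff_imp]
    intro h
    simpa using Finset.card_le_card h
  have hpw := pairwise_levelList m m
  have hnd : (levelList m m).Nodup := hpw.imp fun h => h.2
  have hlen : (levelList m m).length = 2 ^ m := by
    rw [← List.toFinset_card_of_nodup hnd,
      show (levelList m m).toFinset = (Finset.range m).powerset by ext s; simp [hmem]]
    simp
  have hget : ∀ i, (hi : i < 2 ^ m) →
      (levelList m m).getD i ∅ = (levelList m m)[i]'(by rw [hlen]; exact hi) :=
    fun i hi => List.getD_eq_getElem _ _ (by rw [hlen]; exact hi)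
  refine ⟨fun i => (levelList m m).getD i ∅, ?_, ?_, ?_, ?_, ?_⟩
  · intro i hi
    simp only [hget i hi]
    exact Finset.mem_powerset.1 ((hmem _).1 (List.getElem_mem _))
  · intro i hi j hj h
    simp only [hget i hi, hget j hj] at h
    exact (hnd.getElem_inj_iff).1 h
  · intro s hs
    obtain ⟨i, hi, rfl⟩ := List.getElem_of_mem ((hmem s).2 (Finset.mem_powerset.2 hs))
    exact ⟨i, hlen ▸ hi, hget i (hlen ▸ hi)⟩
  · intro i j hij hj
    rcases hij.eq_or_lt with rfl | hij
    · exact le_rfl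
    simp only [hget i (hij.trans hj), hget j hj]
    exact (List.pairwise_iff_getElem.1 hpw i j _ _ hij).1
  · intro i hi
    simp only [hget i (by omega), hget (i + 1) hi]
    exact List.isChain_iff_getElem.1 (isChain_levelList le_rfl) i (by rw [hlen]; exact hi)

/-! ### Characters and the sign rows -/

/-- The sign `(-1) ^ |s ∩ t|`. -/
noncomputable def interSign (s t : Finset ℕ) : ℝ := ∏ w ∈ s, if w ∈ t then -1 else 1

theorem interSign_eq_or (s t : Finset ℕ) : interSign s t = 1 ∨ interSign s t = -1 := by
  unfold interSign
  induction s using Finset.induction_on with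
  | empty => simp
  | insert a s ha ih =>
    rw [Finset.prod_insert ha]
    split_ifs <;> rcases ih with h | h <;> simp [h]

theorem abs_interSign (s t : Finset ℕ) : |interSign s t| = 1 := by
  rcases interSign_eq_or s t with h | h <;> simp [h]

theorem interSign_empty (t : Finset ℕ) : interSign ∅ t = 1 := by simp [interSign]

theorem interSign_union {s s' : Finset ℕ} (h : Disjoint s s') (t : Finset ℕ) :
    interSign (s ∪ s') t = interSign s t * interSign s' t :=
  Finset.prod_union h

theorem interSign_of_disjoint {s t : Finset ℕ} (h : Disjoint t s) : interSign s t = 1 :=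
  Finset.prod_eq_one fun _ hw => if_neg fun hw' => Finset.disjoint_left.1 h hw' hw

/-- The sum expands `∏ w ∈ s, (1 ± 1)`, which vanishes as soon as one sign is negative. -/
theorem sum_powerset_interSign (s t : Finset ℕ) :
    ∑ σ ∈ s.powerset, interSign σ t = if Disjoint t s then 2 ^ s.card else 0 := by
  have h := Finset.prod_one_add (f := fun w => if w ∈ t then (-1 : ℝ) else 1) s
  simp only [interSign, ← h]
  split_ifs with hd
  · rw [Finset.prod_congr rfl fun w hw => by
      rw [if_neg fun hw' => Finset.disjoint_left.1 hd hw' hw]]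
    norm_num
  · obtain ⟨w, hw, hw'⟩ := Finset.not_disjoint_iff.1 hd
    exact Finset.prod_eq_zero hw' (by simp [hw])

theorem sum_powerset_interSign_mul (u s t : Finset ℕ) (hs : s ⊆ u) (ht : t ⊆ u) :
    ∑ σ ∈ u.powerset, interSign σ s * interSign σ t = if s = t then 2 ^ u.card else 0 := by
  have h := Finset.prod_one_add
    (f := fun w => (if w ∈ s then (-1 : ℝ) else 1) * if w ∈ t then -1 else 1) u
  simp only [interSign, ← Finset.prod_mul_distrib, ← h]
  split_ifs with hd
  · subst hd
    rw [Finset.prod_congr rfl fun w hw => by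
      rw [show ((if w ∈ s then (-1 : ℝ) else 1) * if w ∈ s then -1 else 1) = 1 by
        split_ifs <;> norm_num]]
    norm_num
  · obtain ⟨w, hw⟩ : ∃ w, ¬ (w ∈ s ↔ w ∈ t) := by
      by_contra! hc
      exact hd (Finset.ext hc)
    have hwu : w ∈ u := by
      by_contra hwu
      exact hw ⟨fun h => absurd (hs h) hwu, fun h => absurd (ht h) hwu⟩
    refine Finset.prod_eq_zero hwu ?_
    by_cases h1 : w ∈ s <;> by_cases h2 : w ∈ t <;> simp_all

/-- The `±1` rows of the construction: `p` and `q` are consecutive sets of the enumeration. -/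
noncomputable def rowSign (p q t : Finset ℕ) : ℝ :=
  if Disjoint t (p ∩ q) then interSign q t else -interSign p t

theorem rowSign_eq_or (p q t : Finset ℕ) : rowSign p q t = 1 ∨ rowSign p q t = -1 := by
  unfold rowSign
  split_ifs
  · exact interSign_eq_or _ _
  · rcases interSign_eq_or p t with h | h <;> simp [h]

/-- The sum over `σ` acts as the indicator of `t` being disjoint from `p ∩ q`. Where it is nonzero,
the sum contributes `χ_p + χ_q` after scaling, so subtracting `χ_p` leaves `χ_q`; elsewhere only
`-χ_p` remains. Thus a short character combination is a sign vector. -/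
theorem two_pow_mul_rowSign (p q t : Finset ℕ) :
    2 ^ (p ∩ q).card * rowSign p q t =
      ∑ σ ∈ (p ∩ q).powerset, (interSign (σ ∪ (p \ q)) t + interSign (σ ∪ (q \ p)) t) -
        2 ^ (p ∩ q).card * interSign p t := by
  have h1 : ∀ σ ∈ (p ∩ q).powerset, interSign (σ ∪ (p \ q)) t + interSign (σ ∪ (q \ p)) t =
      interSign σ t * (interSign (p \ q) t + interSign (q \ p) t) := by
    intro σ hσ
    have hσ := Finset.mem_powerset.1 hσ
    have hp : Disjoint σ (p \ q) := (Finset.disjoint_sdiff_inter p q).symm.mono_left hσ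
    have hq : Disjoint σ (q \ p) :=
      (Finset.disjoint_sdiff_inter q p).symm.mono_left (by rwa [Finset.inter_comm])
    rw [interSign_union hp, interSign_union hq]
    ring
  rw [Finset.sum_congr rfl h1, ← Finset.sum_mul, sum_powerset_interSign, rowSign]
  split_ifs with hd
  · have hp : interSign p t = interSign (p \ q) t := by
      conv_lhs => rw [← Finset.sdiff_union_inter p q]
      rw [interSign_union (Finset.disjoint_sdiff_inter p q), interSign_of_disjoint hd, mul_one]
    have hq : interSign q t = interSign (q \ p) t := by
      conv_lhs => rw [← Finset.sdiff_union_inter q p]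
      rw [interSign_union (Finset.disjoint_sdiff_inter q p), Finset.inter_comm,
        interSign_of_disjoint hd, mul_one]
    rw [hp, hq]
    ring
  · ring

/-! ### Growth under forward substitution -/

/-- Growth of a sequence that satisfies the recurrence obtained by forward substitution. -/
theorem rpow_le_of_recurrence {N c : ℕ} {X : ℕ → ℝ} {k : ℕ → ℕ}
    (hrec : ∀ i, c ≤ i → i + 1 < N → ∀ B, (∀ j < i, |X j| ≤ B) →
      |X (i + 1) - (2 ^ (k (i + 1) - 1) - 1) * X i| ≤ 2 ^ k (i + 1) * B)
    (hk : ∀ i, c ≤ i → i + 1 < N → 6 ≤ k (i + 1) ∧ k (i + 1) ≤ k i + 1)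
    (h0 : ∀ j < c, X j = 0) (hc : 1 ≤ X c)
    (hsum : ∑ j ∈ Finset.range (c + 1), ((k j : ℝ) - 1 - 128 * (1 / 2) ^ k j) ≤ 0) :
    ∀ i, c ≤ i → i < N →
      (2 : ℝ) ^ (∑ j ∈ Finset.range (i + 1), ((k j : ℝ) - 1 - 128 * (1 / 2) ^ k j)) ≤ X i := by
  -- The induction also needs `X i` to dominate all earlier values by `2 ^ (k i - 2)`, so that the
  -- lower-order terms stay within `8 * X i`.
  suffices h : ∀ i, c ≤ i → i < N →
      (2 : ℝ) ^ (∑ j ∈ Finset.range (i + 1), ((k j : ℝ) - 1 - 128 * (1 / 2) ^ k j)) ≤ X i ∧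
      ∀ j < i, |X j| * 2 ^ (k i - 2) ≤ X i from fun i hi hiN => (h i hi hiN).1
  intro i hi
  induction i, hi using Nat.le_induction with
  | base =>
    intro _
    refine ⟨(Real.rpow_le_one_of_one_le_of_nonpos (by norm_num) hsum).trans hc, ?_⟩
    intro j hj
    rw [h0 j hj]
    simp
    linarith
  | succ i hi ih =>
    intro hiN
    obtain ⟨ih1, ih2⟩ := ih (by omega)
    obtain ⟨hk1, hk2⟩ := hk i hi hiN
    have hXi : 0 < X i := lt_of_lt_of_le (Real.rpow_pos_of_pos (by norm_num) _) ih1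
    have hr := hrec i hi hiN (X i / 2 ^ (k i - 2)) fun j hj => by
      rw [le_div_iff₀ (by positivity)]
      exact ih2 j hj
    obtain ⟨l, hl⟩ : ∃ l, k (i + 1) = l + 6 := ⟨k (i + 1) - 6, by omega⟩
    have hkk : (2 : ℝ) ^ k (i + 1) ≤ 8 * 2 ^ (k i - 2) := by
      calc (2 : ℝ) ^ k (i + 1) ≤ 2 ^ (3 + (k i - 2)) :=
            pow_le_pow_right₀ (by norm_num) (by omega)
        _ = _ := by rw [pow_add]; norm_num
    have hr' : 2 ^ k (i + 1) * (X i / 2 ^ (k i - 2)) ≤ 8 * X i := by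
      rw [mul_div_assoc', div_le_iff₀ (by positivity)]
      nlinarith
    -- The `9` is `1` from the leading coefficient plus `8` from the error. Size at least `6` gives
    -- `2 ^ (k (i + 1) - 2) ≥ 16 > 9`, which restores the domination.
    have hlow : (2 ^ (k (i + 1) - 1) - 9) * X i ≤ X (i + 1) := by
      have := (abs_le.1 (hr.trans hr')).1
      linarith
    have hl1 : (1 : ℝ) ≤ 2 ^ l := one_le_pow₀ (by norm_num)
    have e1 : (2 : ℝ) ^ (k (i + 1) - 1) = 32 * 2 ^ l := by
      rw [hl, show l + 6 - 1 = 5 + l by omega, pow_add]; norm_num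
    have e2 : (2 : ℝ) ^ (k (i + 1) - 2) = 16 * 2 ^ l := by
      rw [hl, show l + 6 - 2 = 4 + l by omega, pow_add]; norm_num
    constructor
    · rw [Finset.sum_range_succ, Real.rpow_add (by norm_num)]
      have hfac : (2 : ℝ) ^ ((k (i + 1) : ℝ) - 1 - 128 * (1 / 2) ^ k (i + 1)) ≤
          2 ^ (k (i + 1) - 1) - 9 := by
        have hx : (2 : ℝ) ^ ((k (i + 1) : ℝ) - 1) = 2 ^ (k (i + 1) - 1) := by
          rw [← Real.rpow_natCast, Nat.cast_sub (by omega), Nat.cast_one]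
        rw [Real.rpow_sub (by norm_num), hx, e1, div_le_iff₀ (by positivity)]
        have hu : (1 / 2 : ℝ) ^ k (i + 1) = 1 / (64 * 2 ^ l) := by
          rw [hl, one_div_pow, pow_add]
          norm_num
          ring
        -- The right side is `4 ^ (1 / 2 ^ l) ≥ 1 + log 4 / 2 ^ l`, and `log 4 ≥ 1`.
        have hb : 1 + 1 / (2 ^ l) ≤ (2 : ℝ) ^ (128 * (1 / 2 : ℝ) ^ k (i + 1)) := by
          rw [hu]
          have hexp : (128 : ℝ) * (1 / (64 * 2 ^ l)) = 2 * (1 / 2 ^ l) := by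
            field_simp; norm_num
          rw [hexp, Real.rpow_mul (by norm_num)]
          have hy0 : (0 : ℝ) ≤ 1 / 2 ^ l := by positivity
          have hlog : 1 ≤ Real.log 4 := by
            rw [Real.le_log_iff_exp_le (by norm_num)]
            linarith [Real.exp_one_lt_d9]
          have := Real.add_one_le_exp (Real.log 4 * (1 / 2 ^ l))
          rw [Real.rpow_two, show (2 : ℝ) ^ 2 = 4 by norm_num, Real.rpow_def_of_pos (by norm_num)]
          nlinarith
        have : 0 ≤ 32 * (2 : ℝ) ^ l - 9 := by linarith
        calc 32 * (2 : ℝ) ^ l ≤ (32 * 2 ^ l - 9) * (1 + 1 / 2 ^ l) := by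
              have : (32 * (2 : ℝ) ^ l - 9) * (1 + 1 / 2 ^ l) =
                  32 * 2 ^ l + 23 - 9 * (1 / 2 ^ l) := by
                field_simp; ring
              rw [this]
              have : 1 / (2 : ℝ) ^ l ≤ 1 := by
                rw [div_le_one (by positivity)]; exact hl1
              linarith
          _ ≤ _ := mul_le_mul_of_nonneg_left hb this
      refine le_trans ?_ hlow
      rw [mul_comm]
      exact mul_le_mul hfac ih1 (Real.rpow_nonneg (by norm_num) _) (by rw [e1]; linarith)
    · have hX : X i * 2 ^ (k (i + 1) - 2) ≤ X (i + 1) := by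
        refine le_trans ?_ hlow
        rw [e1, e2, mul_comm]
        exact mul_le_mul_of_nonneg_right (by linarith) hXi.le
      intro j hj
      rcases (Nat.lt_succ_iff.1 hj).eq_or_lt with rfl | hj
      · rwa [abs_of_pos hXi]
      · refine le_trans (mul_le_mul_of_nonneg_right ?_ (by positivity)) hX
        refine le_trans ?_ (ih2 j hj)
        exact le_mul_of_one_le_right (abs_nonneg _) (one_le_pow₀ (by norm_num))

/-! ### The triangular system of character sums -/

/-- `α` enumerates the subsets of `{0, …, m - 1}` by increasing cardinality such that each one has
exactly one element outside its predecessor. -/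
structure IsSubsetEnum (m : ℕ) (α : ℕ → Finset ℕ) : Prop where
  subset : ∀ i < 2 ^ m, α i ⊆ Finset.range m
  inj : ∀ i < 2 ^ m, ∀ j < 2 ^ m, α i = α j → i = j
  surj : ∀ s ⊆ Finset.range m, ∃ i < 2 ^ m, α i = s
  mono : ∀ i j, i ≤ j → j < 2 ^ m → (α i).card ≤ (α j).card
  step : ∀ i, i + 1 < 2 ^ m → (α (i + 1) \ α i).card = 1

namespace IsSubsetEnum

variable {m : ℕ} {α : ℕ → Finset ℕ}

theorem zero (h : IsSubsetEnum m α) : α 0 = ∅ := by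
  obtain ⟨i, hi, hi'⟩ := h.surj ∅ (by simp)
  have := h.mono 0 i (Nat.zero_le _) hi
  simpa [hi'] using this

theorem card_inter (h : IsSubsetEnum m α) {i : ℕ} (hi : i + 1 < 2 ^ m) :
    (α i ∩ α (i + 1)).card + 1 = (α (i + 1)).card := by
  have := Finset.card_sdiff_add_card_inter (α (i + 1)) (α i)
  rw [h.step i hi, Finset.inter_comm] at this
  omega

theorem card_le (h : IsSubsetEnum m α) {i : ℕ} (hi : i + 1 < 2 ^ m) :
    (α (i + 1)).card ≤ (α i).card + 1 := by
  rw [← h.card_inter hi]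
  have := Finset.card_le_card (Finset.inter_subset_left (s₁ := α i) (s₂ := α (i + 1)))
  omega

/-- The sets used in the row of `α (i + 1)`, besides `α i` and `α (i + 1)`, precede `α i`. -/
theorem exists_lt_of_ssubset (h : IsSubsetEnum m α) {i : ℕ} (hi : i + 1 < 2 ^ m) {σ : Finset ℕ}
    (hσ : σ ⊂ α i ∩ α (i + 1)) :
    (∃ j < i, α j = σ ∪ (α i \ α (i + 1))) ∧ ∃ j < i, α j = σ ∪ (α (i + 1) \ α i) := by
  have hcard := Finset.card_lt_card hσ
  have hsub := hσ.1
  have hlt : ∀ {s : Finset ℕ} {l : ℕ}, l < 2 ^ m → s ⊆ Finset.range m → s.card < (α l).card →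
      ∃ j < l, α j = s := by
    intro s l hl hs hsl
    obtain ⟨j, hj, rfl⟩ := h.surj s hs
    refine ⟨j, ?_, rfl⟩
    by_contra! hc
    exact absurd (h.mono l j hc hj) (by omega)
  constructor
  · apply hlt (by omega)
    · exact Finset.union_subset ((hsub.trans Finset.inter_subset_left).trans (h.subset i (by omega)))
        (Finset.sdiff_subset.trans (h.subset i (by omega)))
    · have h1 := Finset.card_union_le σ (α i \ α (i + 1))
      have h2 := Finset.card_sdiff_add_card_inter (α i) (α (i + 1))
      omega
  · obtain ⟨j, hj, hj'⟩ : ∃ j < i + 1, α j = σ ∪ (α (i + 1) \ α i) := by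
      apply hlt hi
      · exact Finset.union_subset
          ((hsub.trans Finset.inter_subset_right).trans (h.subset _ hi))
          (Finset.sdiff_subset.trans (h.subset _ hi))
      · have h1 := Finset.card_union_le σ (α (i + 1) \ α i)
        have h2 := h.step i hi
        have h3 := h.card_inter hi
        omega
    refine ⟨j, lt_of_le_of_ne (by omega) ?_, hj'⟩
    rintro rfl
    obtain ⟨w, hw⟩ := Finset.card_eq_one.1 (h.step j hi)
    have hw1 : w ∈ α (j + 1) \ α j := by rw [hw]; simp
    have hw2 : w ∈ α j := by rw [hj']; exact Finset.mem_union_right _ hw1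
    exact (Finset.mem_sdiff.1 hw1).2 hw2

end IsSubsetEnum

/-- The combination of the values `y j` with the signs of `s` against the enumerated sets. -/
noncomputable def signSum {N : ℕ} (α : ℕ → Finset ℕ) (y : Fin N → ℝ) (s : Finset ℕ) : ℝ :=
  ∑ j : Fin N, interSign s (α j) * y j

/-- The combination of the values `y j` with the signs of row `i` of the construction. -/
noncomputable def rowSum {N : ℕ} (α : ℕ → Finset ℕ) (y : Fin N → ℝ) (i : ℕ) : ℝ :=
  ∑ j : Fin N, rowSign (α (i - 1)) (α i) (α j) * y j

theorem two_pow_mul_rowSum {N : ℕ} (α : ℕ → Finset ℕ) (y : Fin N → ℝ) (i : ℕ) :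
    2 ^ (α i ∩ α (i + 1)).card * rowSum α y (i + 1) =
      ∑ σ ∈ (α i ∩ α (i + 1)).powerset, (signSum α y (σ ∪ (α i \ α (i + 1))) +
        signSum α y (σ ∪ (α (i + 1) \ α i))) -
        2 ^ (α i ∩ α (i + 1)).card * signSum α y (α i) := by
  simp only [rowSum, signSum, Nat.add_sub_cancel, Finset.mul_sum, ← mul_assoc,
    two_pow_mul_rowSign, ← Finset.sum_add_distrib, ← add_mul]
  rw [Finset.sum_comm, ← Finset.sum_sub_distrib]
  refine Finset.sum_congr rfl fun j _ => ?_
  rw [sub_mul, Finset.sum_mul]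

/-- In the expansion of a row, the term `σ = α i ∩ α (i + 1)` yields the two leading sums. Every
proper `σ` yields two sums of sets preceding `α i`, each bounded by `B`. -/
theorem abs_signSum_succ_sub_le {m N : ℕ} {α : ℕ → Finset ℕ} (h : IsSubsetEnum m α)
    (y : Fin N → ℝ) {i : ℕ} (hi : i + 1 < 2 ^ m) {B : ℝ} (hB0 : 0 ≤ B)
    (hB : ∀ j < i, |signSum α y (α j)| ≤ B) :
    |signSum α y (α (i + 1)) - (2 ^ ((α (i + 1)).card - 1) * rowSum α y (i + 1) +
      (2 ^ ((α (i + 1)).card - 1) - 1) * signSum α y (α i))| ≤ 2 ^ (α (i + 1)).card * B := by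
  have hc := h.card_inter hi
  have hc' : (α (i + 1)).card - 1 = (α i ∩ α (i + 1)).card := by omega
  have hrow := two_pow_mul_rowSum α y i
  have hsplit : ∀ g : Finset ℕ → ℝ, ∑ σ ∈ (α i ∩ α (i + 1)).powerset, g σ =
      ∑ σ ∈ (α i ∩ α (i + 1)).ssubsets, g σ + g (α i ∩ α (i + 1)) := by
    intro g
    rw [Finset.ssubsets, Finset.sum_erase_add _ _ (Finset.mem_powerset_self _)]
  rw [hsplit, Finset.union_comm _ (α i \ _), Finset.sdiff_union_inter,
    Finset.inter_comm (α i) (α (i + 1)), Finset.union_comm _ (α (i + 1) \ _),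
    Finset.sdiff_union_inter, Finset.inter_comm (α (i + 1)) (α i)] at hrow
  rw [hc', hrow]
  have hsum : |∑ σ ∈ (α i ∩ α (i + 1)).ssubsets, (signSum α y (σ ∪ (α i \ α (i + 1))) +
        signSum α y (σ ∪ (α (i + 1) \ α i)))| ≤ 2 ^ (α (i + 1)).card * B := by
    have hle : ∀ σ ∈ (α i ∩ α (i + 1)).ssubsets, |signSum α y (σ ∪ (α i \ α (i + 1))) +
        signSum α y (σ ∪ (α (i + 1) \ α i))| ≤ 2 * B := by
      intro σ hσ
      obtain ⟨⟨j, hj, ej⟩, l, hl, el⟩ := h.exists_lt_of_ssubset hi (Finset.mem_ssubsets.1 hσ)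
      rw [← ej, ← el, two_mul]
      exact (abs_add_le _ _).trans (add_le_add (hB j hj) (hB l hl))
    refine (Finset.abs_sum_le_sum_abs _ _).trans ((Finset.sum_le_card_nsmul _ _ _ hle).trans ?_)
    rw [nsmul_eq_mul, ← mul_assoc]
    refine mul_le_mul_of_nonneg_right ?_ hB0
    rw [← hc, pow_succ]
    refine mul_le_mul_of_nonneg_right ?_ (by norm_num)
    have := Finset.card_le_card (Finset.erase_subset (α i ∩ α (i + 1))
      (α i ∩ α (i + 1)).powerset)
    rw [Finset.card_powerset] at this
    exact_mod_cast this
  refine le_trans (le_of_eq ?_) hsum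
  rw [← abs_neg]
  congr 1
  ring

theorem signSum_eq_zero {m N : ℕ} {α : ℕ → Finset ℕ} (h : IsSubsetEnum m α) (y : Fin N → ℝ)
    (h0 : signSum α y (α 0) = 0) {c : ℕ} (hc : c ≤ 2 ^ m)
    (hrow : ∀ i, i + 1 < c → rowSum α y (i + 1) = 0) : ∀ i < c, signSum α y (α i) = 0 := by
  intro i
  induction i using Nat.strong_induction_on with
  | _ i ih =>
    intro hi
    cases i with
    | zero => exact h0
    | succ i =>
      have := abs_signSum_succ_sub_le h y (hi.trans_le hc) le_rfl
        (fun j hj => by rw [ih j (by omega) (by omega), abs_zero])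
      rw [hrow i hi, ih i (by omega) (by omega)] at this
      simpa using this

/-- Fourier inversion: character orthogonality recovers the vector from its character sums. -/
theorem sum_interSign_mul_signSum {m : ℕ} {α : ℕ → Finset ℕ} (h : IsSubsetEnum m α)
    (y : Fin (2 ^ m) → ℝ) (j : Fin (2 ^ m)) :
    ∑ σ ∈ (Finset.range m).powerset, interSign σ (α j) * signSum α y σ = 2 ^ m * y j := by
  simp only [signSum, Finset.mul_sum, ← mul_assoc]
  rw [Finset.sum_comm, Finset.sum_eq_single j]
  · rw [← Finset.sum_mul, sum_powerset_interSign_mul _ _ _ (h.subset j j.2) (h.subset j j.2)]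
    simp
  · intro l _ hl
    rw [← Finset.sum_mul, sum_powerset_interSign_mul _ _ _ (h.subset j j.2) (h.subset l l.2),
      if_neg, zero_mul]
    intro hjl
    exact hl (Fin.ext (h.inj _ j.2 _ l.2 hjl).symm)
  · simp

/-! ### A large inverse entry at powers of two -/

/-- The `0/1`-matrix of order `2 ^ m` built from an enumeration of subsets. -/
noncomputable def enumMatrix (m : ℕ) (α : ℕ → Finset ℕ) : Matrix (Fin (2 ^ m)) (Fin (2 ^ m)) ℝ :=
  Matrix.of fun i j =>
    if (i : ℕ) = 0 then 1 else (1 - rowSign (α ((i : ℕ) - 1)) (α i) (α j)) / 2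

theorem isZeroOne_enumMatrix (m : ℕ) (α : ℕ → Finset ℕ) : IsZeroOne (enumMatrix m α) := by
  intro i j
  simp only [enumMatrix, Matrix.of_apply]
  split_ifs
  · simp
  · rcases rowSign_eq_or (α ((i : ℕ) - 1)) (α i) (α j) with h | h <;> rw [h] <;> norm_num

theorem enumMatrix_mulVec_zero {m : ℕ} {α : ℕ → Finset ℕ} (h : IsSubsetEnum m α)
    (y : Fin (2 ^ m) → ℝ) {i : Fin (2 ^ m)} (hi : (i : ℕ) = 0) :
    (enumMatrix m α).mulVec y i = signSum α y (α 0) := by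
  simp only [Matrix.mulVec, dotProduct, enumMatrix, Matrix.of_apply, hi, if_true, signSum, h.zero,
    interSign_empty]

theorem enumMatrix_mulVec_of_ne {m : ℕ} {α : ℕ → Finset ℕ} (h : IsSubsetEnum m α)
    (y : Fin (2 ^ m) → ℝ) {i : Fin (2 ^ m)} (hi : (i : ℕ) ≠ 0) :
    (enumMatrix m α).mulVec y i = (signSum α y (α 0) - rowSum α y i) / 2 := by
  simp only [Matrix.mulVec, dotProduct, enumMatrix, hi, signSum, h.zero, interSign_empty, rowSum,
    Matrix.of_apply, if_false, ← Finset.sum_sub_distrib, Finset.sum_div]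
  exact Finset.sum_congr rfl fun j _ => by ring

/-- Forward substitution annihilates every character sum of a kernel vector, and Fourier inversion
then annihilates the vector. -/
theorem isUnit_enumMatrix {m : ℕ} {α : ℕ → Finset ℕ} (h : IsSubsetEnum m α) :
    IsUnit (enumMatrix m α) := by
  rw [Matrix.isUnit_iff_isUnit_det, isUnit_iff_ne_zero]
  intro hdet
  obtain ⟨y, hy, hMy⟩ := Matrix.exists_mulVec_eq_zero_iff.2 hdet
  apply hy
  have h0 : signSum α y (α 0) = 0 := by
    rw [← enumMatrix_mulVec_zero h y (i := ⟨0, by positivity⟩) rfl, hMy, Pi.zero_apply]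
  have hz := signSum_eq_zero h y h0 le_rfl fun i hi => by
    have := enumMatrix_mulVec_of_ne h y (i := ⟨i + 1, hi⟩) (by simp)
    rw [hMy, h0, Pi.zero_apply] at this
    simp only at this
    linarith
  funext j
  have := sum_interSign_mul_signSum h y j
  rw [Finset.sum_eq_zero fun σ hσ => by
    obtain ⟨i, hi, rfl⟩ := h.surj σ (Finset.mem_powerset.1 hσ)
    rw [hz i hi, mul_zero]] at this
  have h2 : (2 : ℝ) ^ m ≠ 0 := by positivity
  simpa [h2] using this.symm

theorem sum_powerset_range_card (m : ℕ) :
    ∑ s ∈ (Finset.range m).powerset, (s.card : ℝ) = m * 2 ^ m / 2 := by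
  induction m with
  | zero => simp
  | succ m ih =>
    rw [Finset.range_add_one, Finset.sum_powerset_insert (by simp), ih]
    rw [Finset.sum_congr rfl fun s hs => by
      rw [Finset.card_insert_of_notMem fun hm => by simpa using Finset.mem_powerset.1 hs hm]]
    push_cast
    rw [Finset.sum_add_distrib, ih]
    simp
    ring

theorem sum_powerset_range_half_pow (m : ℕ) :
    ∑ s ∈ (Finset.range m).powerset, (1 / 2 : ℝ) ^ s.card = (3 / 2) ^ m := by
  have h := Finset.prod_one_add (f := fun _ => (1 / 2 : ℝ)) (Finset.range m)
  simp only [Finset.prod_const] at h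
  rw [← h]
  norm_num

theorem IsSubsetEnum.sum_range {m : ℕ} {α : ℕ → Finset ℕ} (h : IsSubsetEnum m α)
    (g : Finset ℕ → ℝ) :
    ∑ i ∈ Finset.range (2 ^ m), g (α i) = ∑ s ∈ (Finset.range m).powerset, g s := by
  refine Finset.sum_nbij α ?_ ?_ ?_ fun _ _ => rfl
  · intro i hi
    exact Finset.mem_powerset.2 (h.subset i (Finset.mem_range.1 hi))
  · intro i hi j hj
    exact h.inj i (by simpa using hi) j (by simpa using hj)
  · intro s hs
    obtain ⟨i, hi, rfl⟩ := h.surj s (Finset.mem_powerset.1 hs)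
    exact ⟨i, by simpa using hi, rfl⟩

theorem abs_inv_le_maxInvEntry {n : ℕ} (A : Matrix (Fin n) (Fin n) ℝ) (i j : Fin n) :
    |A⁻¹ i j| ≤ maxInvEntry A :=
  le_ciSup (f := fun p : Fin n × Fin n => |A⁻¹ p.1 p.2|) (Set.finite_range _).bddAbove (i, j)

theorem rpow_le_maxInvEntry_enumMatrix {m : ℕ} (hm : 1 ≤ m) {α : ℕ → Finset ℕ}
    (h : IsSubsetEnum m α) :
    (2 : ℝ) ^ ((m : ℝ) * 2 ^ m / 2 - 2 ^ m - 128 * (3 / 2) ^ m) ≤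
      2 ^ m * maxInvEntry (enumMatrix m α) := by
  have hN : 2 ≤ 2 ^ m := by simpa using Nat.pow_le_pow_right (n := 2) (by norm_num) hm
  -- The growth estimate needs sizes at least `6`, so the unit right-hand side is put at the last
  -- set of size at most `5`.
  set c := Nat.findGreatest (fun i => (α i).card ≤ 5) (2 ^ m - 1) with hc_def
  have hα1 : (α 1).card ≤ 5 := by
    have := h.card_le (i := 0) (by omega)
    rw [h.zero] at this
    simp at this
    omega
  have hc1 : 1 ≤ c := Nat.le_findGreatest (by omega) hα1
  have hcN : c < 2 ^ m := by
    have := Nat.findGreatest_le (P := fun i => (α i).card ≤ 5) (2 ^ m - 1)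
    omega
  have hc5 : (α c).card ≤ 5 :=
    Nat.findGreatest_spec (P := fun i => (α i).card ≤ 5) (m := 1) (by omega) hα1
  have hgt : ∀ i, c ≤ i → i + 1 < 2 ^ m → 6 ≤ (α (i + 1)).card := by
    intro i hi hiN
    have := Nat.findGreatest_is_greatest (P := fun i => (α i).card ≤ 5) (n := 2 ^ m - 1)
      (k := i + 1) (by omega) (by omega)
    omega
  have hdet := (Matrix.isUnit_iff_isUnit_det _).1 (isUnit_enumMatrix h)
  -- A `0/1` row is half of the all-ones row minus the sign row; the factor `-1/2` makes the sign
  -- row `c` sum to exactly `1`.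
  set y : Fin (2 ^ m) → ℝ := fun j => -(1 / 2) * (enumMatrix m α)⁻¹ j ⟨c, hcN⟩ with hy_def
  have hMy : ∀ i, (enumMatrix m α).mulVec y i = if (i : ℕ) = c then -(1 / 2) else 0 := by
    intro i
    have h1 : (enumMatrix m α * (enumMatrix m α)⁻¹) i ⟨c, hcN⟩ =
        (1 : Matrix (Fin (2 ^ m)) (Fin (2 ^ m)) ℝ) i ⟨c, hcN⟩ := by
      rw [Matrix.mul_nonsing_inv _ hdet]
    have h2 : (enumMatrix m α).mulVec y i =
        -(1 / 2) * (enumMatrix m α * (enumMatrix m α)⁻¹) i ⟨c, hcN⟩ := by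
      rw [Matrix.mul_apply, Finset.mul_sum]
      simp only [Matrix.mulVec, dotProduct, hy_def]
      exact Finset.sum_congr rfl fun j _ => by ring
    rw [h2, h1, Matrix.one_apply]
    simp only [Fin.ext_iff]
    split_ifs <;> simp
  have h0 : signSum α y (α 0) = 0 := by
    rw [← enumMatrix_mulVec_zero h y (i := ⟨0, by omega⟩) rfl, hMy, if_neg]
    simp only
    omega
  have hrow : ∀ i, i + 1 < 2 ^ m → rowSum α y (i + 1) = if i + 1 = c then 1 else 0 := by
    intro i hi
    have h1 := enumMatrix_mulVec_of_ne h y (i := ⟨i + 1, hi⟩) (by simp)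
    rw [h0, hMy] at h1
    simp only at h1
    split_ifs at h1 ⊢ <;> linarith
  have hz := signSum_eq_zero h y h0 hcN.le fun i hi => by
    rw [hrow i (by omega), if_neg (by omega)]
  have hXc : 1 ≤ signSum α y (α c) := by
    obtain ⟨d, hd⟩ : ∃ d, c = d + 1 := ⟨c - 1, by omega⟩
    have h1 := abs_signSum_succ_sub_le h y (i := d) (by omega) le_rfl
      (fun j hj => by rw [hz j (by omega), abs_zero])
    rw [hrow d (by omega), if_pos hd.symm, hz d (by omega), ← hd] at h1
    simp only [mul_one, mul_zero, add_zero, abs_nonpos_iff, sub_eq_zero] at h1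
    rw [h1]
    exact one_le_pow₀ (by norm_num)
  have hgrow := rpow_le_of_recurrence (N := 2 ^ m) (c := c) (X := fun i => signSum α y (α i))
    (k := fun i => (α i).card) ?_ ?_ hz hXc ?_ (2 ^ m - 1) (by omega) (by omega)
  · rw [Nat.sub_add_cancel (by omega),
      h.sum_range fun s => (s.card : ℝ) - 1 - 128 * (1 / 2) ^ s.card, Finset.sum_sub_distrib,
      Finset.sum_sub_distrib, ← Finset.mul_sum, sum_powerset_range_card,
      sum_powerset_range_half_pow] at hgrow
    simp only [Finset.sum_const, Finset.card_powerset, Finset.card_range, nsmul_eq_mul,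
      mul_one] at hgrow
    push_cast at hgrow
    refine hgrow.trans ((le_abs_self _).trans ?_)
    unfold signSum
    refine (Finset.abs_sum_le_sum_abs _ _).trans ?_
    refine (Finset.sum_le_card_nsmul _ _ (maxInvEntry (enumMatrix m α)) fun j _ => ?_).trans ?_
    · rw [abs_mul, abs_interSign, one_mul, hy_def, abs_mul]
      have h1 := abs_inv_le_maxInvEntry (enumMatrix m α) j ⟨c, hcN⟩
      have h2 : |(-(1 / 2) : ℝ)| = 1 / 2 := by rw [abs_neg]; norm_num
      rw [h2]
      linarith [abs_nonneg ((enumMatrix m α)⁻¹ j ⟨c, hcN⟩)]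
    · simp
  · intro i hi hiN B hB
    have hB0 : 0 ≤ B := (abs_nonneg _).trans (hB 0 (by omega))
    have h1 := abs_signSum_succ_sub_le h y hiN hB0 hB
    rwa [hrow i hiN, if_neg (by omega), mul_zero, zero_add] at h1
  · exact fun i hi hiN => ⟨hgt i hi hiN, h.card_le hiN⟩
  -- This fixes the constant `128`: the exponent `k - 1 - 128 / 2 ^ k` is negative for `k < 5` and
  -- zero for `k = 5`.
  · refine Finset.sum_nonpos fun j hj => ?_
    have hj5 : (α j).card ≤ 5 :=
      (h.mono j c (by simpa [Nat.lt_succ_iff] using hj) hcN).trans hc5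
    interval_cases (α j).card <;> norm_num

/-! ### Supermultiplicativity and the lower bound for all sizes -/

theorem maxInvEntry_le_chi {n : ℕ} {A : Matrix (Fin n) (Fin n) ℝ} (hA : IsZeroOne A)
    (hu : IsUnit A) : maxInvEntry A ≤ chi n :=
  (isGreatest_chi n).2 ⟨A, hA, hu, rfl⟩

theorem exists_maxInvEntry_eq {n : ℕ} (hn : 1 ≤ n) (A : Matrix (Fin n) (Fin n) ℝ) :
    ∃ i j, |A⁻¹ i j| = maxInvEntry A := by
  have : Nonempty (Fin n × Fin n) := ⟨(⟨0, hn⟩, ⟨0, hn⟩)⟩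
  obtain ⟨p, hp⟩ := exists_eq_ciSup_of_finite (f := fun p : Fin n × Fin n => |A⁻¹ p.1 p.2|)
  exact ⟨p.1, p.2, hp⟩

theorem one_le_chi {n : ℕ} (hn : 1 ≤ n) : 1 ≤ chi n := by
  refine le_trans ?_ (maxInvEntry_le_chi (isZeroOne_one n) isUnit_one)
  have := abs_inv_le_maxInvEntry (1 : Matrix (Fin n) (Fin n) ℝ) ⟨0, hn⟩ ⟨0, hn⟩
  simpa using this

/-- The function `chi` is supermultiplicative. -/
theorem chi_mul_chi_le {s t : ℕ} (hs : 1 ≤ s) (ht : 1 ≤ t) : chi s * chi t ≤ chi (s + t) := by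
  obtain ⟨A, hA, hAu, hAe⟩ := (isGreatest_chi s).1
  obtain ⟨B, hB, hBu, hBe⟩ := (isGreatest_chi t).1
  obtain ⟨q, j, hqj⟩ := exists_maxInvEntry_eq hs A
  obtain ⟨i, p, hip⟩ := exists_maxInvEntry_eq ht B
  -- The lower-left block of the inverse is `-B⁻¹ E A⁻¹`; a single `1` at `(p, q)` multiplies the
  -- two extremal entries.
  set E : Matrix (Fin t) (Fin s) ℝ := Matrix.single p q 1 with hE
  set M := Matrix.fromBlocks A 0 E B with hM
  have hMu : IsUnit M := by
    rw [hM, Matrix.isUnit_fromBlocks_zero₁₂]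
    exact ⟨hAu, hBu⟩
  have hinv : M⁻¹ (Sum.inr i) (Sum.inl j) = -(B⁻¹ i p * A⁻¹ q j) := by
    rw [hM, Matrix.inv_fromBlocks_zero₁₂_of_isUnit_iff _ _ _ (iff_of_true hAu hBu)]
    simp only [Matrix.fromBlocks_apply₂₁, Matrix.neg_apply]
    rw [Matrix.mul_assoc, Matrix.mul_apply, Finset.sum_eq_single p]
    · simp [hE]
    · intro b _ hb
      simp [hE, hb]
    · simp
  have h01 : IsZeroOne (Matrix.reindex finSumFinEquiv finSumFinEquiv M) := by
    intro x y
    rw [Matrix.reindex_apply, Matrix.submatrix_apply, hM]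
    rcases finSumFinEquiv.symm x with a | a <;> rcases finSumFinEquiv.symm y with b | b
    · exact hA a b
    · exact Or.inl rfl
    · simp only [Matrix.fromBlocks_apply₂₁, hE, Matrix.single_apply]
      split_ifs <;> simp
    · exact hB a b
  have hu : IsUnit (Matrix.reindex finSumFinEquiv finSumFinEquiv M) := by
    rw [Matrix.isUnit_iff_isUnit_det, Matrix.det_reindex_self]
    exact (Matrix.isUnit_iff_isUnit_det _).1 hMu
  have h1 := abs_inv_le_maxInvEntry (Matrix.reindex finSumFinEquiv finSumFinEquiv M)
    (finSumFinEquiv (Sum.inr i)) (finSumFinEquiv (Sum.inl j))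
  rw [Matrix.inv_reindex, Matrix.reindex_apply, Matrix.submatrix_apply] at h1
  simp only [Equiv.symm_apply_apply] at h1
  rw [hinv, abs_neg, abs_mul, hqj, hip, hAe, hBe, mul_comm] at h1
  exact h1.trans (maxInvEntry_le_chi h01 hu)

theorem rpow_le_chi_two_pow (m : ℕ) :
    (2 : ℝ) ^ ((m : ℝ) * 2 ^ m / 2 - 2 ^ m - 130 * (3 / 2) ^ m) ≤ chi (2 ^ m) := by
  rcases Nat.eq_zero_or_pos m with rfl | hm
  · refine le_trans ?_ (one_le_chi (by simp))
    apply Real.rpow_le_one_of_one_le_of_nonpos <;> norm_num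
  · obtain ⟨α, h1, h2, h3, h4, h5⟩ := exists_enum_subsets m
    have h : IsSubsetEnum m α := ⟨h1, h2, h3, h4, h5⟩
    have hb := rpow_le_maxInvEntry_enumMatrix hm h
    have hc := maxInvEntry_le_chi (isZeroOne_enumMatrix m α) (isUnit_enumMatrix h)
    -- This absorbs the factor `2 ^ m` on the right of the previous bound and turns `128` into
    -- `130`.
    have hm2 : (m : ℝ) ≤ 2 * (3 / 2) ^ m := by
      have := one_add_mul_le_pow (a := (1 / 2 : ℝ)) (by norm_num) m
      norm_num at this
      linarith
    have h2m : (0 : ℝ) < 2 ^ m := by positivity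
    refine le_trans ?_ ((div_le_iff₀' h2m).2 hb |>.trans hc)
    rw [le_div_iff₀ h2m, ← Real.rpow_natCast 2 m, ← Real.rpow_add (by norm_num)]
    apply Real.rpow_le_rpow_of_exponent_le (by norm_num)
    rw [Real.rpow_natCast]
    linarith

/-- The binary entropy of a splitting is at most one bit. -/
theorem add_mul_logb_add_le {a r : ℝ} (ha : 0 < a) (hr : 0 < r) :
    (a + r) * Real.logb 2 (a + r) ≤ a * Real.logb 2 a + r * Real.logb 2 r + (a + r) := by
  have h := Real.convexOn_mul_log.2 (Set.mem_Ici.2 ha.le) (Set.mem_Ici.2 hr.le)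
    (show (0 : ℝ) ≤ 1 / 2 by norm_num) (show (0 : ℝ) ≤ 1 / 2 by norm_num) (by norm_num)
  simp only [smul_eq_mul] at h
  rw [show 1 / 2 * a + 1 / 2 * r = (a + r) / 2 by ring,
    Real.log_div (by positivity) (by norm_num)] at h
  have hl : 0 < Real.log 2 := Real.log_pos (by norm_num)
  have key : (a + r) * Real.log (a + r) ≤
      a * Real.log a + r * Real.log r + (a + r) * Real.log 2 := by linarith
  simp only [Real.logb]
  rw [← sub_nonneg] at key ⊢
  have : a * (Real.log a / Real.log 2) + r * (Real.log r / Real.log 2) + (a + r) -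
      (a + r) * (Real.log (a + r) / Real.log 2) =
      (a * Real.log a + r * Real.log r + (a + r) * Real.log 2 -
        (a + r) * Real.log (a + r)) / Real.log 2 := by
    field_simp
  rw [this]
  positivity

/-- Write `n = 2 ^ m + r`. The split loses at most `n / 2` in the exponent, which the slack `2 ^ m`
(from `1` instead of `2` per unit on that part) covers because `r ≤ 2 ^ m`. The errors form a
geometric series of ratio `2/3`, whence `390 = 3 * 130`. -/
theorem rpow_le_chi {n : ℕ} (hn : 1 ≤ n) :
    (2 : ℝ) ^ ((n : ℝ) * Real.logb 2 n / 2 - 2 * n - 390 * (3 / 2) ^ Nat.log 2 n) ≤ chi n := by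
  induction n using Nat.strong_induction_on with
  | _ n ih =>
    set m := Nat.log 2 n with hm
    have hle : 2 ^ m ≤ n := Nat.pow_log_le_self 2 (by omega)
    have hlt : n < 2 ^ (m + 1) := Nat.lt_pow_succ_log_self (by norm_num) n
    have hpow := rpow_le_chi_two_pow m
    have hlogb : Real.logb 2 (2 ^ m) = m := by
      rw [← Real.rpow_natCast, Real.logb_rpow (by norm_num) (by norm_num)]
    have h32 : (0 : ℝ) < (3 / 2) ^ m := by positivity
    have h2m : (0 : ℝ) < 2 ^ m := by positivity
    rcases hle.eq_or_lt with heq | hlt'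
    · rw [← heq]
      refine le_trans (Real.rpow_le_rpow_of_exponent_le (by norm_num) ?_) hpow
      push_cast
      rw [hlogb]
      linarith
    · obtain ⟨r, hr⟩ : ∃ r, n = 2 ^ m + r := ⟨n - 2 ^ m, by omega⟩
      have hr1 : 1 ≤ r := by omega
      have hr2 : r < 2 ^ m := by rw [pow_succ] at hlt; omega
      have hlogr : Nat.log 2 r + 1 ≤ m := Nat.log_lt_of_lt_pow (by omega) hr2
      have hpr : (3 / 2 : ℝ) * (3 / 2) ^ Nat.log 2 r ≤ (3 / 2) ^ m := by
        rw [← pow_succ']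
        exact pow_le_pow_right₀ (by norm_num) hlogr
      have ihr := ih r (by have := Nat.two_pow_pos m; omega) hr1
      have hmul := chi_mul_chi_le (Nat.one_le_two_pow (n := m)) hr1
      rw [← hr] at hmul
      refine le_trans ?_ hmul
      refine le_trans ?_ (mul_le_mul hpow ihr (Real.rpow_nonneg (by norm_num) _)
        (zero_le_one.trans (one_le_chi Nat.one_le_two_pow)))
      rw [← Real.rpow_add (by norm_num)]
      refine Real.rpow_le_rpow_of_exponent_le (by norm_num) ?_
      have hr0 : (0 : ℝ) < r := by exact_mod_cast hr1
      have hent := add_mul_logb_add_le h2m hr0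
      rw [hlogb] at hent
      have hr2' : (r : ℝ) ≤ 2 ^ m := by exact_mod_cast hr2.le
      rw [hr]
      push_cast
      linarith

/-! ### Upper bounds -/

/-- Hadamard's inequality. -/
theorem Matrix.abs_det_le_prod_norm {n : ℕ} (S : Matrix (Fin n) (Fin n) ℝ) :
    |S.det| ≤ ∏ i, ‖WithLp.toLp 2 (S i)‖ := by
  have : Fact (Module.finrank ℝ (EuclideanSpace ℝ (Fin n)) = n) := ⟨by simp⟩
  set b := EuclideanSpace.basisFun (Fin n) ℝ with hb
  have h := (b.toBasis.orientation).abs_volumeForm_apply_le fun i => WithLp.toLp 2 (S i)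
  rw [Orientation.volumeForm_robust _ b rfl, Module.Basis.det_apply] at h
  convert h using 2
  rw [← Matrix.det_transpose]
  congr 1

theorem Matrix.abs_det_le_of_sign {n : ℕ} (S : Matrix (Fin n) (Fin n) ℝ)
    (hS : ∀ i j, S i j = 1 ∨ S i j = -1) : |S.det| ≤ (n : ℝ) ^ ((n : ℝ) / 2) := by
  refine S.abs_det_le_prod_norm.trans (le_of_eq ?_)
  have hrow : ∀ i, ‖WithLp.toLp 2 (S i)‖ = Real.sqrt n := by
    intro i
    rw [EuclideanSpace.norm_eq]
    congr 1
    rw [Finset.sum_congr rfl fun j _ => by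
      rw [show ‖(WithLp.toLp 2 (S i)).ofLp j‖ ^ 2 = 1 by
        rcases hS i j with h | h <;> simp [h]]]
    simp
  rw [Finset.prod_congr rfl fun i _ => hrow i, Finset.prod_const, Finset.card_univ,
    Fintype.card_fin, Real.sqrt_eq_rpow, ← Real.rpow_natCast, ← Real.rpow_mul (by positivity)]
  congr 1
  ring

/-- Bordering `1 - 2 B` by ones gives a sign matrix of order `k + 1`, whose Schur complement is `-2
B`. -/
theorem IsZeroOne.det_le {k : ℕ} {B : Matrix (Fin k) (Fin k) ℝ} (hB : IsZeroOne B) :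
    B.det ≤ ((k + 1 : ℕ) : ℝ) ^ (((k + 1 : ℕ) : ℝ) / 2) / 2 ^ k := by
  set S : Matrix (Fin 1 ⊕ Fin k) (Fin 1 ⊕ Fin k) ℝ :=
    Matrix.fromBlocks 1 (Matrix.of fun _ _ => 1) (Matrix.of fun _ _ => 1)
      (Matrix.of fun i j => 1 - 2 * B i j) with hS
  have hdet : S.det = (-2) ^ k * B.det := by
    rw [hS, Matrix.det_fromBlocks_one₁₁]
    rw [show (Matrix.of fun i j => 1 - 2 * B i j) -
        (Matrix.of fun _ _ => 1 : Matrix (Fin k) (Fin 1) ℝ) *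
        (Matrix.of fun _ _ => 1 : Matrix (Fin 1) (Fin k) ℝ) = (-2 : ℝ) • B by
      ext i j
      simp [Matrix.mul_apply]]
    rw [Matrix.det_smul, Fintype.card_fin]
  set e : Fin 1 ⊕ Fin k ≃ Fin (k + 1) :=
    finSumFinEquiv.trans (finCongr (Nat.add_comm 1 k)) with he
  have hle := Matrix.abs_det_le_of_sign (Matrix.reindex e e S) (by
    intro x y
    rw [Matrix.reindex_apply, Matrix.submatrix_apply, hS]
    rcases e.symm x with a | a <;> rcases e.symm y with b | b
    · left
      rw [Matrix.fromBlocks_apply₁₁, Subsingleton.elim a b, Matrix.one_apply_eq]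
    · exact Or.inl rfl
    · exact Or.inl rfl
    · rw [Matrix.fromBlocks_apply₂₂, Matrix.of_apply]
      rcases hB a b with h | h <;> rw [h] <;> norm_num)
  rw [Matrix.det_reindex_self, hdet, abs_mul, abs_pow, abs_neg, abs_of_pos (by norm_num)] at hle
  rw [le_div_iff₀' (by positivity)]
  exact (mul_le_mul_of_nonneg_left (le_abs_self _) (by positivity)).trans hle

theorem rho_le (k : ℕ) : rho k ≤ ((k + 1 : ℕ) : ℝ) ^ (((k + 1 : ℕ) : ℝ) / 2) / 2 ^ k := by
  obtain ⟨B, hB, h⟩ := (isGreatest_rho k).1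
  rw [← h]
  exact hB.det_le

theorem IsZeroOne.abs_det_le_rho {k : ℕ} {B : Matrix (Fin k) (Fin k) ℝ} (hB : IsZeroOne B) :
    |B.det| ≤ rho k := by
  have hpos : B.det ≤ rho k := (isGreatest_rho k).2 ⟨B, hB, rfl⟩
  refine abs_le'.2 ⟨hpos, ?_⟩
  -- A row swap flips the sign of the determinant but needs two rows.
  match k, B, hB, hpos with
  | 0, B, _, hpos =>
    rw [Matrix.det_fin_zero] at hpos ⊢
    linarith
  | 1, B, hB, hpos =>
    rw [Matrix.det_fin_one] at hpos ⊢
    rcases hB 0 0 with h | h <;> rw [h] at hpos ⊢ <;> linarith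
  | k + 2, B, hB, _ =>
    refine (isGreatest_rho _).2 ⟨B.submatrix (Equiv.swap 0 1) id, fun i j => hB _ _, ?_⟩
    rw [Matrix.det_permute, Equiv.Perm.sign_swap (by simp)]
    simp

/-- The integer matrix underlying a `0/1`-matrix. -/
theorem IsZeroOne.exists_int {n : ℕ} {A : Matrix (Fin n) (Fin n) ℝ} (hA : IsZeroOne A) :
    ∃ Z : Matrix (Fin n) (Fin n) ℤ, (∀ i j, Z i j = 0 ∨ Z i j = 1) ∧
      Z.map (Int.castRingHom ℝ) = A := by
  refine ⟨Matrix.of fun i j => if A i j = 1 then 1 else 0, ?_, ?_⟩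
  · intro i j
    simp only [Matrix.of_apply]
    split_ifs <;> simp
  · ext i j
    rcases hA i j with h | h <;> simp [h]

/-- Cramer's rule, with a nonzero integer determinant in the denominator. -/
theorem chi_succ_le_rho (k : ℕ) : chi (k + 1) ≤ rho k := by
  obtain ⟨A, hA, hu, hmax⟩ := (isGreatest_chi (k + 1)).1
  obtain ⟨i, j, hij⟩ := exists_maxInvEntry_eq (Nat.le_add_left 1 k) A
  have hdet := (Matrix.isUnit_iff_isUnit_det _).1 hu
  have h1 : 1 ≤ |A.det| := by
    obtain ⟨Z, -, rfl⟩ := hA.exists_int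
    rw [← RingHom.mapMatrix_apply, ← RingHom.map_det] at hdet ⊢
    have hz : Z.det ≠ 0 := fun h => by simp [h] at hdet
    have := Int.one_le_abs hz
    rw [eq_intCast, ← Int.cast_abs]
    exact_mod_cast this
  rw [← hmax, ← hij, Matrix.inv_def, Matrix.smul_apply, Ring.inverse_eq_inv', smul_eq_mul, abs_mul,
    abs_inv, Matrix.adjugate_fin_succ_eq_det_submatrix, abs_mul, abs_pow, abs_neg, abs_one,
    one_pow, one_mul]
  have h2 : |(A.submatrix j.succAbove i.succAbove).det| ≤ rho k :=
    IsZeroOne.abs_det_le_rho fun _ _ => hA _ _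
  exact (mul_le_of_le_one_left (abs_nonneg _) (inv_le_one_of_one_le₀ h1)).trans h2

/-! ### Primitive recursive arithmetic and the error exponent -/

theorem Primrec.nat_pow : Primrec₂ ((· ^ ·) : ℕ → ℕ → ℕ) := by
  have h : Primrec₂ fun (a n : ℕ) => (Nat.rec 1 (fun _ r => r * a) n : ℕ) :=
    Primrec.nat_rec (Primrec.const 1)
      (Primrec.nat_mul.comp (Primrec.snd.comp Primrec.snd) Primrec.fst).to₂
  refine h.of_eq fun a n => ?_
  induction n with
  | zero => rfl
  | succ n ih => simp only [pow_succ, ← ih]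

theorem Primrec.sum_range {β : Type*} [Primcodable β] {g : β → ℕ} {f : β → ℕ → ℕ}
    (hg : Primrec g) (hf : Primrec₂ f) : Primrec fun b => ∑ k ∈ Finset.range (g b), f b k := by
  have h : Primrec fun b => (Nat.rec 0 (fun k r => r + f b k) (g b) : ℕ) :=
    Primrec.nat_rec' hg (Primrec.const 0)
      (Primrec.nat_add.comp (Primrec.snd.comp Primrec.snd)
        (hf.comp Primrec.fst (Primrec.fst.comp Primrec.snd))).to₂
  refine h.of_eq fun b => ?_
  induction g b with
  | zero => simp
  | succ n ih => rw [Finset.sum_range_succ, ← ih]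

/-- The exponent of the error factor at sizes between `2 ^ m` and `2 ^ (m + 1)`. -/
def lossExp (m : ℕ) : ℕ := 390 * (3 ^ m / 2 ^ m + 1)

/-- Rounding up makes the error a natural number, so that the bound can be tested in integer
arithmetic. -/
theorem le_lossExp (m : ℕ) : 390 * (3 / 2 : ℝ) ^ m ≤ lossExp m := by
  have h := (Nat.lt_mul_div_succ (3 ^ m) (Nat.two_pow_pos m)).le
  have h' : (3 : ℝ) ^ m ≤ 2 ^ m * ((3 ^ m / 2 ^ m : ℕ) + 1) := by exact_mod_cast h
  rw [lossExp, div_pow, Nat.cast_mul, Nat.cast_add, Nat.cast_one, Nat.cast_ofNat]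
  refine mul_le_mul_of_nonneg_left ?_ (by norm_num)
  rwa [div_le_iff₀' (by positivity)]

theorem lossExp_le (m : ℕ) : (lossExp m : ℝ) ≤ 780 * (3 / 2) ^ m := by
  have h : ((3 ^ m / 2 ^ m : ℕ) : ℝ) ≤ (3 / 2) ^ m := by
    have := Nat.cast_div_le (α := ℝ) (m := 3 ^ m) (n := 2 ^ m)
    rw [div_pow]
    exact_mod_cast this
  have h1 : (1 : ℝ) ≤ (3 / 2) ^ m := one_le_pow₀ (by norm_num)
  rw [lossExp, Nat.cast_mul, Nat.cast_add, Nat.cast_one, Nat.cast_ofNat]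
  linarith

theorem primrec_lossExp : Primrec lossExp :=
  Primrec.nat_mul.comp (Primrec.const 390) <| Primrec.succ.comp <|
    Primrec.nat_div.comp (Primrec.nat_pow.comp (Primrec.const 3) Primrec.id)
      (Primrec.nat_pow.comp (Primrec.const 2) Primrec.id)

theorem tendsto_log_two_atTop : Tendsto (Nat.log 2) atTop atTop :=
  tendsto_atTop_atTop.2 fun b => ⟨2 ^ b, fun n hn =>
    Nat.le_log_of_pow_le (by norm_num) hn⟩

/-- With `m = Nat.log 2 n`, `(3/2)^m = (3/4)^m 2^m ≤ (3/4)^m n`. -/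
theorem isLittleO_lossExp_log :
    (fun n : ℕ => (lossExp (Nat.log 2 n) : ℝ)) =o[atTop] (fun n : ℕ => (n : ℝ)) := by
  have h1 : (fun n : ℕ => (lossExp (Nat.log 2 n) : ℝ)) =O[atTop]
      fun n : ℕ => (3 / 4 : ℝ) ^ Nat.log 2 n * n := by
    refine IsBigO.of_bound 780 ?_
    filter_upwards [eventually_ge_atTop 1] with n hn
    rw [Real.norm_of_nonneg (by positivity), Real.norm_of_nonneg (by positivity)]
    refine (lossExp_le _).trans (mul_le_mul_of_nonneg_left ?_ (by norm_num))
    have h : (2 : ℝ) ^ Nat.log 2 n ≤ n := by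
      exact_mod_cast Nat.pow_log_le_self 2 (by omega)
    calc (3 / 2 : ℝ) ^ Nat.log 2 n = (3 / 4) ^ Nat.log 2 n * 2 ^ Nat.log 2 n := by
          rw [← mul_pow]; norm_num
      _ ≤ _ := mul_le_mul_of_nonneg_left h (by positivity)
  refine h1.trans_isLittleO ?_
  have h2 : (fun n : ℕ => (3 / 4 : ℝ) ^ Nat.log 2 n) =o[atTop] fun _ : ℕ => (1 : ℝ) := by
    rw [isLittleO_one_iff]
    exact (tendsto_pow_atTop_nhds_zero_of_lt_one (by norm_num) (by norm_num)).comp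
      tendsto_log_two_atTop
  simpa using h2.mul_isBigO (isBigO_refl (fun n : ℕ => (n : ℝ)) atTop)

/-- The base-two logarithm of the denominator in the lower bound for size `n`,
where `2 ^ m ≤ n < 2 ^ (m + 1)`. -/
def lowerExp (n m : ℕ) : ℕ := if n = 2 ^ m then n + lossExp m else 2 * n + lossExp m

theorem rpow_half_le_chi_mul {n : ℕ} (hn : 1 ≤ n) :
    (n : ℝ) ^ ((n : ℝ) / 2) ≤ chi n * 2 ^ lowerExp n (Nat.log 2 n) := by
  have hn0 : (0 : ℝ) < n := by exact_mod_cast hn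
  have hpow : (n : ℝ) ^ ((n : ℝ) / 2) = 2 ^ ((n : ℝ) * Real.logb 2 n / 2) := by
    rw [show (n : ℝ) * Real.logb 2 n / 2 = Real.logb 2 n * (n / 2) by ring,
      Real.rpow_mul (by norm_num),
      Real.rpow_logb (by norm_num) (by norm_num) hn0]
  have key : ∀ {x : ℝ}, (2 : ℝ) ^ ((n : ℝ) * Real.logb 2 n / 2 - x) ≤ chi n →
      x ≤ lowerExp n (Nat.log 2 n) →
      (n : ℝ) ^ ((n : ℝ) / 2) ≤ chi n * 2 ^ lowerExp n (Nat.log 2 n) := by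
    intro x hx hle
    rw [hpow, ← sub_add_cancel ((n : ℝ) * Real.logb 2 n / 2) x, Real.rpow_add (by norm_num)]
    refine mul_le_mul hx ?_ (by positivity) (zero_le_one.trans (one_le_chi hn))
    rw [← Real.rpow_natCast]
    exact Real.rpow_le_rpow_of_exponent_le (by norm_num) hle
  have hloss := le_lossExp (Nat.log 2 n)
  by_cases h : n = 2 ^ Nat.log 2 n
  · have hc := rpow_le_chi_two_pow (Nat.log 2 n)
    have hlogb : Real.logb 2 n = Nat.log 2 n := by
      conv_lhs => rw [h]
      push_cast
      rw [← Real.rpow_natCast, Real.logb_rpow (by norm_num) (by norm_num)]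
    have hcast : (2 : ℝ) ^ Nat.log 2 n = n := by exact_mod_cast h.symm
    rw [← h, hcast] at hc
    refine key (x := n + 130 * (3 / 2) ^ Nat.log 2 n) ?_ ?_
    · rw [hlogb]
      convert hc using 2
      ring
    · rw [lowerExp, if_pos h]
      push_cast
      have : (0 : ℝ) < (3 / 2) ^ Nat.log 2 n := by positivity
      linarith
  · refine key (x := 2 * n + 390 * (3 / 2) ^ Nat.log 2 n) ?_ ?_
    · convert rpow_le_chi hn using 2
      ring
    · rw [lowerExp, if_neg h]
      push_cast
      linarith

/-! ### Checkable certificates -/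

/-- The entry `(i, j)` of the `n × n` matrix stored row by row in the list `L`. -/
def listEntry (L : List ℕ) (n i j : ℕ) : ℕ := L.getD (n * i + j) 0

theorem exists_listEntry {n : ℕ} (F : Fin n → Fin n → ℕ) :
    ∃ L, ∀ i j : Fin n, listEntry L n i j = F i j := by
  refine ⟨List.ofFn fun t : Fin (n * n) =>
    F (finProdFinEquiv.symm t).1 (finProdFinEquiv.symm t).2, fun i j => ?_⟩
  have hval : n * (i : ℕ) + j = (finProdFinEquiv (i, j) : Fin (n * n)) := by
    simp [finProdFinEquiv, Nat.add_comm]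
  have hlt : n * (i : ℕ) + j < n * n := hval ▸ Fin.isLt _
  have hfin : (⟨n * (i : ℕ) + j, hlt⟩ : Fin (n * n)) = finProdFinEquiv (i, j) := Fin.ext hval
  rw [listEntry, List.getD_eq_getElem _ _ (by rwa [List.length_ofFn]), List.getElem_ofFn, hfin,
    Equiv.symm_apply_apply]

theorem primrec_listEntry {β : Type*} [Primcodable β] {L : β → List ℕ} {n i j : β → ℕ}
    (hL : Primrec L) (hn : Primrec n) (hi : Primrec i) (hj : Primrec j) :
    Primrec fun b => listEntry (L b) (n b) (i b) (j b) :=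
  (Primrec.list_getD 0).comp hL (Primrec.nat_add.comp (Primrec.nat_mul.comp hn hi) hj)

/-- The entry of a stored matrix, with everything but `1` replaced by `0`. -/
def listBit (L : List ℕ) (n i j : ℕ) : ℕ := if listEntry L n i j = 1 then 1 else 0

theorem primrec_listBit {β : Type*} [Primcodable β] {L : β → List ℕ} {n i j : β → ℕ}
    (hL : Primrec L) (hn : Primrec n) (hi : Primrec i) (hj : Primrec j) :
    Primrec fun b => listBit (L b) (n b) (i b) (j b) :=
  Primrec.ite (Primrec.eq.comp (primrec_listEntry hL hn hi hj) (Primrec.const 1))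
    (Primrec.const 1) (Primrec.const 0)

/-- A certificate `(m, d, r, c, A, P, Q)`: a matrix `A`, integer matrices `P` and `Q` with
`A * (P - Q) = d • 1`, and the position `(r, c)` of a large entry of `A⁻¹`. -/
abbrev Certificate : Type := ℕ × ℕ × ℕ × ℕ × List ℕ × List ℕ × List ℕ

/-- The distance of two natural numbers. -/
def natDist (x y : ℕ) : ℕ := (x - y) + (y - x)

theorem cast_natDist (x y : ℕ) : (natDist x y : ℝ) = |(x : ℝ) - y| := by
  rcases le_total x y with h | h
  · have h' : (x : ℝ) ≤ y := by exact_mod_cast h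
    rw [natDist, Nat.sub_eq_zero_of_le h, zero_add, Nat.cast_sub h, abs_of_nonpos (by linarith)]
    ring
  · have h' : (y : ℝ) ≤ x := by exact_mod_cast h
    rw [natDist, Nat.sub_eq_zero_of_le h, add_zero, Nat.cast_sub h, abs_of_nonneg (by linarith)]

theorem primrec_natDist {β : Type*} [Primcodable β] {x y : β → ℕ} (hx : Primrec x)
    (hy : Primrec y) : Primrec fun b => natDist (x b) (y b) :=
  Primrec.nat_add.comp (Primrec.nat_sub.comp hx hy) (Primrec.nat_sub.comp hy hx)

/-- The entry `(i, j)` of the product of the stored matrices `A` and `P`. -/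
def listProd (n : ℕ) (A P : List ℕ) (i j : ℕ) : ℕ :=
  ∑ k ∈ Finset.range n, listBit A n i k * listEntry P n k j

theorem primrec_listProd {β : Type*} [Primcodable β] {n i j : β → ℕ} {A P : β → List ℕ}
    (hn : Primrec n) (hA : Primrec A) (hP : Primrec P) (hi : Primrec i) (hj : Primrec j) :
    Primrec fun b => listProd (n b) (A b) (P b) (i b) (j b) := by
  have h : Primrec fun t : β × ℕ => listBit (A t.1) (n t.1) (i t.1) t.2 *
      listEntry (P t.1) (n t.1) t.2 (j t.1) :=
    Primrec.nat_mul.comp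
      (primrec_listBit (hA.comp Primrec.fst) (hn.comp Primrec.fst) (hi.comp Primrec.fst)
        Primrec.snd)
      (primrec_listEntry (hP.comp Primrec.fst) (hn.comp Primrec.fst) Primrec.snd
        (hj.comp Primrec.fst))
  exact Primrec.sum_range (f := fun b k => listBit (A b) (n b) (i b) k *
    listEntry (P b) (n b) k (j b)) hn h.to₂

/-- The sum over all positions of the differences of `A * P` and `A * Q + d • 1`. -/
def mismatch (n d : ℕ) (A P Q : List ℕ) : ℕ :=
  ∑ i ∈ Finset.range n, ∑ j ∈ Finset.range n,
    natDist (listProd n A P i j) (listProd n A Q i j + if i = j then d else 0)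

theorem primrec_mismatch {β : Type*} [Primcodable β] {n d : β → ℕ} {A P Q : β → List ℕ}
    (hn : Primrec n) (hd : Primrec d) (hA : Primrec A) (hP : Primrec P) (hQ : Primrec Q) :
    Primrec fun b => mismatch (n b) (d b) (A b) (P b) (Q b) := by
  have e : Primrec fun t : (β × ℕ) × ℕ => t.1.1 := Primrec.fst.comp Primrec.fst
  have hi : Primrec fun t : (β × ℕ) × ℕ => t.1.2 := Primrec.snd.comp Primrec.fst
  have hj : Primrec fun t : (β × ℕ) × ℕ => t.2 := Primrec.snd
  have h : Primrec fun t : (β × ℕ) × ℕ =>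
      natDist (listProd (n t.1.1) (A t.1.1) (P t.1.1) t.1.2 t.2)
        (listProd (n t.1.1) (A t.1.1) (Q t.1.1) t.1.2 t.2 +
          if t.1.2 = t.2 then d t.1.1 else 0) :=
    primrec_natDist (primrec_listProd (hn.comp e) (hA.comp e) (hP.comp e) hi hj)
      (Primrec.nat_add.comp (primrec_listProd (hn.comp e) (hA.comp e) (hQ.comp e) hi hj)
        (Primrec.ite (Primrec.eq.comp hi hj) (hd.comp e) (Primrec.const 0)))
  have h' : Primrec fun t : β × ℕ => ∑ j ∈ Finset.range (n t.1),
      natDist (listProd (n t.1) (A t.1) (P t.1) t.2 j)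
        (listProd (n t.1) (A t.1) (Q t.1) t.2 j + if t.2 = j then d t.1 else 0) :=
    Primrec.sum_range (f := fun (t : β × ℕ) j => natDist (listProd (n t.1) (A t.1) (P t.1) t.2 j)
        (listProd (n t.1) (A t.1) (Q t.1) t.2 j + if t.2 = j then d t.1 else 0))
      (hn.comp Primrec.fst) h.to₂
  exact Primrec.sum_range (f := fun b i => ∑ j ∈ Finset.range (n b),
    natDist (listProd (n b) (A b) (P b) i j)
      (listProd (n b) (A b) (Q b) i j + if i = j then d b else 0)) hn h'.to₂

/-- The validity of a certificate for size `n`. -/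
def IsCertificate (n : ℕ) : Certificate → Prop
  | (m, d, r, c, A, P, Q) =>
    (2 ^ m ≤ n ∧ n < 2 ^ (m + 1)) ∧ 0 < d ∧ (r < n ∧ c < n) ∧ mismatch n d A P Q = 0 ∧
      n ^ n * d ^ 2 ≤ natDist (listEntry P n r c) (listEntry Q n r c) ^ 2 * 4 ^ lowerExp n m

theorem primrecPred_isCertificate :
    PrimrecPred fun b : ℕ × Certificate => IsCertificate b.1 b.2 := by
  have hn : Primrec fun b : ℕ × Certificate => b.1 := Primrec.fst
  have h1 : Primrec fun b : ℕ × Certificate => b.2 := Primrec.snd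
  have hm := Primrec.fst.comp h1
  have h2 := Primrec.snd.comp h1
  have hd := Primrec.fst.comp h2
  have h3 := Primrec.snd.comp h2
  have hr := Primrec.fst.comp h3
  have h4 := Primrec.snd.comp h3
  have hc := Primrec.fst.comp h4
  have h5 := Primrec.snd.comp h4
  have hA := Primrec.fst.comp h5
  have h6 := Primrec.snd.comp h5
  have hP := Primrec.fst.comp h6
  have hQ := Primrec.snd.comp h6
  have hexp : Primrec fun b : ℕ × Certificate => lowerExp b.1 b.2.1 :=
    Primrec.ite (Primrec.eq.comp hn (Primrec.nat_pow.comp (Primrec.const 2) hm))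
      (Primrec.nat_add.comp hn (primrec_lossExp.comp hm))
      (Primrec.nat_add.comp (Primrec.nat_mul.comp (Primrec.const 2) hn) (primrec_lossExp.comp hm))
  have hmis := primrec_mismatch hn hd hA hP hQ
  refine (((Primrec.nat_le.comp (Primrec.nat_pow.comp (Primrec.const 2) hm) hn).and
    (Primrec.nat_lt.comp hn (Primrec.nat_pow.comp (Primrec.const 2) (Primrec.succ.comp hm)))).and
    ((Primrec.nat_lt.comp (Primrec.const 0) hd).and
    (((Primrec.nat_lt.comp hr hn).and (Primrec.nat_lt.comp hc hn)).and
    ((Primrec.eq.comp hmis (Primrec.const 0)).and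
    (Primrec.nat_le.comp
      (Primrec.nat_mul.comp (Primrec.nat_pow.comp hn hn)
        (Primrec.nat_pow.comp hd (Primrec.const 2)))
      (Primrec.nat_mul.comp
        (Primrec.nat_pow.comp
          (primrec_natDist (primrec_listEntry hP hn hr hc) (primrec_listEntry hQ hn hr hc))
          (Primrec.const 2))
        (Primrec.nat_pow.comp (Primrec.const 4) hexp))))))).of_eq fun b => ?_
  rfl

theorem rpow_half_sq {n : ℕ} : ((n : ℝ) ^ ((n : ℝ) / 2)) ^ 2 = n ^ n := by
  rw [← Real.rpow_natCast, ← Real.rpow_mul (by positivity), Nat.cast_ofNat,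
    div_mul_cancel₀ _ (by norm_num), Real.rpow_natCast]

/-- A valid certificate proves a lower bound for the inverse of its matrix. -/
theorem IsCertificate.isUnit_and_le {a : ℕ × ℕ × ℕ → Bool} {n m d r c : ℕ} {A P Q : List ℕ}
    (h : IsCertificate n (m, d, r, c, A, P, Q))
    (ha : ∀ i j, a (n, i, j) = decide (listEntry A n i j = 1)) :
    IsUnit (zeroOneMatrix a n) ∧
      (n : ℝ) ^ ((n : ℝ) / 2) ≤ maxInvEntry (zeroOneMatrix a n) * 2 ^ lowerExp n m := by
  obtain ⟨-, hd, ⟨hr, hc⟩, hmis, hle⟩ := h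
  have hd0 : (0 : ℝ) < d := by exact_mod_cast hd
  set M := zeroOneMatrix a n with hM
  set X : Matrix (Fin n) (Fin n) ℝ :=
    Matrix.of fun i j => (listEntry P n i j : ℝ) - listEntry Q n i j with hX
  have hentry : ∀ i k : Fin n, M i k = (listBit A n i k : ℝ) := by
    intro i k
    simp only [hM, zeroOneMatrix, Matrix.of_apply, ha, listBit, decide_eq_true_eq]
    split_ifs <;> simp
  have hprod : ∀ (L : List ℕ) (i j : Fin n),
      (listProd n A L i j : ℝ) = ∑ k, M i k * (listEntry L n k j : ℝ) := by
    intro L i j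
    rw [listProd, Finset.sum_range]
    push_cast
    exact Finset.sum_congr rfl fun k _ => by rw [hentry]
  have hMX : M * X = (d : ℝ) • (1 : Matrix (Fin n) (Fin n) ℝ) := by
    ext i j
    have h1 := (Finset.sum_eq_zero_iff.1 hmis) i (Finset.mem_range.2 i.2)
    have h2 := (Finset.sum_eq_zero_iff.1 h1) j (Finset.mem_range.2 j.2)
    have h3 : (natDist (listProd n A P i j)
      (listProd n A Q i j + if (i : ℕ) = j then d else 0) : ℝ) = 0 := by exact_mod_cast h2
    rw [cast_natDist, abs_eq_zero, sub_eq_zero, Nat.cast_add, hprod, hprod] at h3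
    rw [Matrix.mul_apply, Matrix.smul_apply, Matrix.one_apply]
    simp only [hX, Matrix.of_apply, mul_sub, Finset.sum_sub_distrib, h3, Fin.ext_iff, smul_eq_mul]
    split_ifs <;> simp
  have hone : M * ((d : ℝ)⁻¹ • X) = 1 := by
    rw [Matrix.mul_smul, hMX, smul_smul, inv_mul_cancel₀ hd0.ne', one_smul]
  refine ⟨IsUnit.of_mul_eq_one _ hone, ?_⟩
  have hinv := Matrix.inv_eq_right_inv hone
  have hmax := abs_inv_le_maxInvEntry M ⟨r, hr⟩ ⟨c, hc⟩
  rw [hinv, Matrix.smul_apply, smul_eq_mul, abs_mul, abs_inv, abs_of_pos hd0] at hmax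
  simp only [hX, Matrix.of_apply] at hmax
  rw [← cast_natDist, inv_mul_le_iff₀ hd0] at hmax
  set D := natDist (listEntry P n r c) (listEntry Q n r c) with hD
  have hle' : (n : ℝ) ^ n * d ^ 2 ≤ (D : ℝ) ^ 2 * 4 ^ lowerExp n m := by exact_mod_cast hle
  -- Certificates state the bound squared, which removes the possibly irrational `n ^ (n / 2)`.
  have hsq : ((n : ℝ) ^ ((n : ℝ) / 2) * d) ^ 2 ≤ (D * 2 ^ lowerExp n m) ^ 2 := by
    rw [mul_pow, mul_pow, rpow_half_sq, ← pow_mul, mul_comm (lowerExp n m), pow_mul]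
    norm_num
    exact hle'
  have hroot := le_of_sq_le_sq hsq (by positivity)
  have h2 : (0 : ℝ) < 2 ^ lowerExp n m := by positivity
  rw [← mul_le_mul_iff_left₀ hd0]
  refine hroot.trans ?_
  calc (D : ℝ) * 2 ^ lowerExp n m ≤ (d * maxInvEntry M) * 2 ^ lowerExp n m :=
        mul_le_mul_of_nonneg_right hmax h2.le
    _ = _ := by ring

/-- A matrix attaining `chi n` supplies one: the adjugate, with the sign of the determinant, is the
integer scaled inverse, split into positive and negative parts. -/
theorem exists_isCertificate {n : ℕ} (hn : 1 ≤ n) : ∃ w, IsCertificate n w := by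
  obtain ⟨M, hM, hu, hmax⟩ := (isGreatest_chi n).1
  obtain ⟨r, c, hrc⟩ := exists_maxInvEntry_eq hn M
  obtain ⟨Z, hZ, hZM⟩ := hM.exists_int
  have hdet := (Matrix.isUnit_iff_isUnit_det _).1 hu
  have hdetZ : M.det = (Z.det : ℝ) := by
    rw [← hZM, ← RingHom.mapMatrix_apply, ← RingHom.map_det, eq_intCast]
  have hZ0 : Z.det ≠ 0 := fun h => by simp [hdetZ, h] at hdet
  set X : Matrix (Fin n) (Fin n) ℤ := Z.det.sign • Z.adjugate with hX
  have hZX : Z * X = (Z.det.natAbs : ℤ) • (1 : Matrix (Fin n) (Fin n) ℤ) := by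
    rw [hX, Matrix.mul_smul, Matrix.mul_adjugate, smul_smul, Int.sign_mul_self_eq_natAbs]
  obtain ⟨A, hA⟩ := exists_listEntry fun i j => (Z i j).toNat
  obtain ⟨P, hP⟩ := exists_listEntry fun i j => (X i j).toNat
  obtain ⟨Q, hQ⟩ := exists_listEntry fun i j => (-X i j).toNat
  have hPQ : ∀ i j : Fin n, (listEntry P n i j : ℤ) - listEntry Q n i j = X i j := by
    intro i j
    rw [hP, hQ]
    omega
  have hbit : ∀ i j : Fin n, (listBit A n i j : ℤ) = Z i j := by
    intro i j
    rw [listBit, hA]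
    rcases hZ i j with h | h <;> simp [h]
  refine ⟨(Nat.log 2 n, Z.det.natAbs, r, c, A, P, Q),
    ⟨Nat.pow_log_le_self 2 (by omega), Nat.lt_pow_succ_log_self (by norm_num) n⟩,
    Int.natAbs_pos.2 hZ0, ⟨r.2, c.2⟩, ?_, ?_⟩
  · refine Finset.sum_eq_zero fun i hi => Finset.sum_eq_zero fun j hj => ?_
    lift i to Fin n using Finset.mem_range.1 hi
    lift j to Fin n using Finset.mem_range.1 hj
    have h1 : (listProd n A P i j : ℤ) - listProd n A Q i j = (Z * X) i j := by
      simp only [listProd, Finset.sum_range, Nat.cast_sum, Nat.cast_mul, Matrix.mul_apply,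
        ← Finset.sum_sub_distrib, ← mul_sub, hPQ, hbit]
    rw [hZX, Matrix.smul_apply, Matrix.one_apply, smul_eq_mul] at h1
    simp only [Fin.ext_iff] at h1
    have h2 : listProd n A P i j =
        listProd n A Q i j + if (i : ℕ) = j then Z.det.natAbs else 0 := by
      split_ifs at h1 ⊢ <;> omega
    rw [h2]
    simp [natDist]
  · have hbound := rpow_half_le_chi_mul hn
    have hchi : chi n * Z.det.natAbs = natDist (listEntry P n r c) (listEntry Q n r c) := by
      rw [cast_natDist]
      have h1 : ((listEntry P n r c : ℝ) - listEntry Q n r c) = (X r c : ℝ) := by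
        rw [← hPQ]
        push_cast
        rfl
      have h2 : M⁻¹ r c * Z.det = (Z.adjugate r c : ℝ) := by
        rw [Matrix.inv_def, Ring.inverse_eq_inv', Matrix.smul_apply, smul_eq_mul, hdetZ,
          inv_mul_eq_div, div_mul_cancel₀ _ (by exact_mod_cast hZ0), ← hZM,
          ← RingHom.mapMatrix_apply, ← RingHom.map_adjugate]
        rfl
      have h3 : |(Z.det.sign : ℝ)| = 1 := by
        rw [← Int.cast_abs, Int.abs_sign_of_ne_zero hZ0, Int.cast_one]
      rw [h1, ← hmax, ← hrc, Nat.cast_natAbs, Int.cast_abs, ← abs_mul, h2, hX, Matrix.smul_apply,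
        smul_eq_mul, Int.cast_mul, abs_mul, h3, one_mul]
    have hsq : ((n : ℝ) ^ ((n : ℝ) / 2) * Z.det.natAbs) ^ 2 ≤
        (natDist (listEntry P n r c) (listEntry Q n r c) *
          2 ^ lowerExp n (Nat.log 2 n)) ^ 2 := by
      refine pow_le_pow_left₀ (by positivity) ?_ 2
      rw [← hchi]
      calc _ ≤ chi n * 2 ^ lowerExp n (Nat.log 2 n) * Z.det.natAbs :=
            mul_le_mul_of_nonneg_right hbound (by positivity)
        _ = _ := by ring
    rw [mul_pow, mul_pow, rpow_half_sq, ← pow_mul, mul_comm (lowerExp _ _), pow_mul,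
      show (2 : ℝ) ^ 2 = 4 by norm_num] at hsq
    generalize Z.det.natAbs = d at hsq ⊢
    exact_mod_cast hsq

/-! ### Effective search and conclusion -/

/-- Unbounded search: a primitive recursive relation that is total has a computable selector. -/
theorem exists_computable_selector {β γ : Type*} [Primcodable β] [Primcodable γ] {R : β → γ → Prop}
    (hR : PrimrecPred fun b : β × γ => R b.1 b.2) (hex : ∀ b, ∃ c, R b c) :
    ∃ g : β → γ, Computable g ∧ ∀ b, R b (g b) := by
  classical
  have hf : Primrec fun t : β × ℕ =>
      (Encodable.decode (α := γ) t.2).bind fun c => if R t.1 c then some c else none := by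
    have hg : Primrec fun u : (β × ℕ) × γ => if R u.1.1 u.2 then some u.2 else none :=
      Primrec.ite (hR.comp ((Primrec.fst.comp Primrec.fst).pair Primrec.snd))
        (Primrec.option_some.comp Primrec.snd) (Primrec.const none)
    exact Primrec.option_bind (Primrec.decode.comp Primrec.snd) hg.to₂
  choose g hg using hex
  have hmem : ∀ b, ∃ c, c ∈ Nat.rfindOpt fun k =>
      (Encodable.decode (α := γ) k).bind fun c => if R b c then some c else none := by
    intro b
    rw [← Part.dom_iff_mem, Nat.rfindOpt_dom]
    exact ⟨Encodable.encode (g b), g b, by simp [hg b]⟩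
  choose s hs using hmem
  refine ⟨s, (Partrec.rfindOpt hf.to₂.to_comp).of_eq_tot hs, fun b => ?_⟩
  obtain ⟨k, hk⟩ := Nat.rfindOpt_spec (hs b)
  obtain ⟨c, -, hc⟩ := Option.bind_eq_some_iff.1 (Option.mem_def.1 hk)
  split_ifs at hc with hRc
  obtain rfl := Option.some.inj hc
  exact hRc

/-- For every size a valid certificate can be found effectively. -/
theorem exists_computable_certificate :
    ∃ w : ℕ → Certificate, Computable w ∧ ∀ n, 1 ≤ n → IsCertificate n (w n) := by
  -- Size `0` has no certificate; accepting anything there keeps the search total.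
  have hpred : PrimrecPred fun b : ℕ × Certificate => b.1 = 0 ∨ IsCertificate b.1 b.2 :=
    PrimrecPred.or (Primrec.eq.comp Primrec.fst (Primrec.const 0)) primrecPred_isCertificate
  obtain ⟨w, hw, hspec⟩ := exists_computable_selector
    (R := fun n w => n = 0 ∨ IsCertificate n w) hpred fun n => by
      rcases Nat.eq_zero_or_pos n with h | h
      · exact ⟨(0, 0, 0, 0, [], [], []), Or.inl h⟩
      · exact (exists_isCertificate h).imp fun _ => Or.inr
  exact ⟨w, hw, fun n hn => (hspec n).resolve_left (by omega)⟩

theorem exists_computable_list :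
    ∃ L : ℕ → List ℕ, Computable L ∧ ∀ n, 1 ≤ n →
      ∃ m d r c P Q, IsCertificate n (m, d, r, c, L n, P, Q) := by
  obtain ⟨w, hw, hcert⟩ := exists_computable_certificate
  have h1 : Computable fun n => (w n).2 := Computable.snd.comp hw
  have h2 : Computable fun n => (w n).2.2 := Computable.snd.comp h1
  have h3 : Computable fun n => (w n).2.2.2 := Computable.snd.comp h2
  have h4 : Computable fun n => (w n).2.2.2.2 := Computable.snd.comp h3
  have h5 : Computable fun n => (w n).2.2.2.2.1 := Computable.fst.comp h4
  exact ⟨fun n => (w n).2.2.2.2.1, h5, fun n hn =>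
    ⟨(w n).1, (w n).2.1, (w n).2.2.1, (w n).2.2.2.1, (w n).2.2.2.2.2.1, (w n).2.2.2.2.2.2,
      hcert n hn⟩⟩

theorem computable_listEntry_eq_one {L : ℕ → List ℕ} (hL : Computable L) :
    Computable fun t : ℕ × ℕ × ℕ => decide (listEntry (L t.1) t.1 t.2.1 t.2.2 = 1) := by
  have hentry : Primrec fun u : List ℕ × ℕ × ℕ × ℕ => listEntry u.1 u.2.1 u.2.2.1 u.2.2.2 :=
    primrec_listEntry Primrec.fst (Primrec.fst.comp Primrec.snd)
      (Primrec.fst.comp (Primrec.snd.comp Primrec.snd))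
      (Primrec.snd.comp (Primrec.snd.comp Primrec.snd))
  have hone : Primrec fun x : ℕ => decide (x = 1) :=
    (Primrec.eq.comp Primrec.id (Primrec.const 1)).decide
  have hlist : Computable fun t : ℕ × ℕ × ℕ => L t.1 := hL.comp Computable.fst
  have hpair : Computable fun t : ℕ × ℕ × ℕ => (L t.1, t) := hlist.pair Computable.id
  have hval : Computable fun t : ℕ × ℕ × ℕ => listEntry (L t.1) t.1 t.2.1 t.2.2 :=
    hentry.to_comp.comp hpair
  exact hone.to_comp.comp hval

/-- The lower bounds are attained by a computable family of matrices. -/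
theorem exists_computable_matrix :
    ∃ a : ℕ × ℕ × ℕ → Bool, Computable a ∧ ∀ n, 1 ≤ n → IsUnit (zeroOneMatrix a n) ∧
      (n : ℝ) ^ ((n : ℝ) / 2) ≤
        maxInvEntry (zeroOneMatrix a n) * 2 ^ lowerExp n (Nat.log 2 n) := by
  obtain ⟨L, hL, hcert⟩ := exists_computable_list
  refine ⟨_, computable_listEntry_eq_one hL, fun n hn => ?_⟩
  obtain ⟨m, d, r, c, P, Q, h⟩ := hcert n hn
  -- The certificate carries `m` itself, so its checker never computes a logarithm; the bounds on
  -- `n` determine it.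
  obtain rfl : Nat.log 2 n = m := (Nat.log_eq_iff (Or.inr ⟨by norm_num, by omega⟩)).2 h.1
  exact h.isUnit_and_le fun i j => rfl

theorem mainTheorem3 :
    ∃ f : ℕ → ℝ, f =o[atTop] (fun n : ℕ => (n : ℝ)) ∧
      -- the bounds for all sizes
      (∀ n : ℕ, 1 ≤ n →
        (n : ℝ) ^ ((n : ℝ) / 2) / (2 : ℝ) ^ (2 * (n : ℝ) + f n) ≤ chi n ∧
        chi n ≤ rho (n - 1) ∧
        rho (n - 1) ≤ (n : ℝ) ^ ((n : ℝ) / 2) / (2 : ℝ) ^ ((n : ℝ) - 1)) ∧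
      -- the better lower bound for powers of two
      (∀ n : ℕ, (∃ m : ℕ, n = 2 ^ m) →
        (n : ℝ) ^ ((n : ℝ) / 2) / (2 : ℝ) ^ ((n : ℝ) + f n) ≤ chi n) ∧
      -- the lower bounds are realized by an effectively constructed family of matrices
      (∃ a : ℕ × ℕ × ℕ → Bool, Computable a ∧
        (∀ n : ℕ, 1 ≤ n → IsUnit (zeroOneMatrix a n) ∧
          (n : ℝ) ^ ((n : ℝ) / 2) / (2 : ℝ) ^ (2 * (n : ℝ) + f n) ≤
            maxInvEntry (zeroOneMatrix a n)) ∧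
        (∀ n : ℕ, (∃ m : ℕ, n = 2 ^ m) →
          (n : ℝ) ^ ((n : ℝ) / 2) / (2 : ℝ) ^ ((n : ℝ) + f n) ≤
            maxInvEntry (zeroOneMatrix a n))) := by
  obtain ⟨a, ha, hbound⟩ := exists_computable_matrix
  have hdiv : ∀ n : ℕ, 1 ≤ n → ∀ x : ℝ, (lowerExp n (Nat.log 2 n) : ℝ) ≤ x →
      (n : ℝ) ^ ((n : ℝ) / 2) / (2 : ℝ) ^ x ≤ maxInvEntry (zeroOneMatrix a n) := by
    intro n hn x hx
    have h := (hbound n hn).2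
    rw [← div_le_iff₀ (by positivity), ← Real.rpow_natCast] at h
    refine le_trans ?_ h
    exact div_le_div_of_nonneg_left (by positivity) (by positivity)
      (Real.rpow_le_rpow_of_exponent_le (by norm_num) hx)
  have hgen : ∀ n : ℕ, 1 ≤ n →
      (n : ℝ) ^ ((n : ℝ) / 2) / (2 : ℝ) ^ (2 * (n : ℝ) + lossExp (Nat.log 2 n)) ≤
        maxInvEntry (zeroOneMatrix a n) := by
    intro n hn
    refine hdiv n hn _ ?_
    have : lowerExp n (Nat.log 2 n) ≤ 2 * n + lossExp (Nat.log 2 n) := by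
      rw [lowerExp]
      split_ifs <;> omega
    exact_mod_cast this
  have hpow : ∀ n : ℕ, (∃ m : ℕ, n = 2 ^ m) →
      (n : ℝ) ^ ((n : ℝ) / 2) / (2 : ℝ) ^ ((n : ℝ) + lossExp (Nat.log 2 n)) ≤
        maxInvEntry (zeroOneMatrix a n) := by
    rintro n ⟨m, hm⟩
    refine hdiv n (hm ▸ Nat.one_le_two_pow) _ ?_
    have : n = 2 ^ Nat.log 2 n := by rw [hm, Nat.log_pow (by norm_num)]
    rw [lowerExp, if_pos this]
    push_cast
    exact le_rfl
  have hchi : ∀ n : ℕ, 1 ≤ n → maxInvEntry (zeroOneMatrix a n) ≤ chi n := fun n hn =>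
    maxInvEntry_le_chi (isZeroOne_zeroOneMatrix a n) (hbound n hn).1
  refine ⟨fun n => lossExp (Nat.log 2 n), isLittleO_lossExp_log, fun n hn => ?_, ?_,
    a, ha, fun n hn => ⟨(hbound n hn).1, hgen n hn⟩, hpow⟩
  · refine ⟨(hgen n hn).trans (hchi n hn), ?_⟩
    obtain ⟨k, rfl⟩ : ∃ k, n = k + 1 := ⟨n - 1, by omega⟩
    refine ⟨chi_succ_le_rho k, (rho_le k).trans (le_of_eq ?_)⟩
    rw [show ((k + 1 : ℕ) : ℝ) - 1 = k by push_cast; ring, Real.rpow_natCast]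
  · intro n hn
    refine (hpow n hn).trans (hchi n ?_)
    obtain ⟨m, rfl⟩ := hn
    exact Nat.one_le_two_pow
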